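/- Let $\gamma>0$ and let $N\ge 2$ be an integer. For $\omega>0$ let $\nu=\nu_{N,\omega}$ be the law of $N$ independent Gamma random variables $\eta_1,\dots,\eta_N$ with shape $\gamma$ and scale $1$, conditioned on $\sum_{i=1}^N\eta_i=\omega$. For $i<j$ let $\nu[f\mid\mathcal F_{i,j}]$ be the conditional expectation of $f$ under $\nu$ given the coordinates $\eta_k$, $k\notin\{i,j\}$, and let $$\mathcal L^*f=\frac1N\sum_{1\le i<j\le N}\bigl(\nu[f\mid\mathcal F_{i,j}]-f\bigr),\qquad f\in L^2(\nu),$$ $$\lambda^*(N,\omega)=\inf\Bigl\{\frac{\nu(f(-\mathcal L^*f))}{\nu(f^2)}\ :\ f\in L^2(\nu),\ \nu(f)=0,\ \nu(f^2)\ne0\Bigr\},\qquad \lambda^*(N)=\inf_{\omega>0}\lambda^*(N,\omega).$$ Then: (i) $\mathcal L^*$ is the generator of the energy exchange process in which each pair collides at rate $1/N$ and redistributes its energy by an independent Beta$(\gamma,\gamma)$ fraction: for all $\omega>0$ and $f\in L^2(\nu_{N,\omega})$, $\nu_{N,\omega}$-almost everywhere, $$\mathcal L^*f(\eta)=\frac1N\sum_{i<j}\int_0^1\bigl[f(T^{i,j}_\alpha\eta)-f(\eta)\bigr]\,\frac{\Gamma(2\gamma)}{\Gamma(\gamma)^2}\{\alpha(1-\alpha)\}^{\gamma-1}\,d\alpha,$$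 where $T^{i,j}_\alpha$ replaces $(\eta_i,\eta_j)$ by $(\alpha(\eta_i+\eta_j),(1-\alpha)(\eta_i+\eta_j))$ and keeps the other coordinates. (ii) For every $\omega>0$, $$\lambda^*(N,\omega)=\lambda^*(N)=\frac{\gamma N+1}{N(2\gamma+1)}.$$ -/

import Mathlib

namespace EnergyExchange

open MeasureTheory ProbabilityTheory
open scoped ENNReal

/-- The reference law of `N` independent site energies: the product of `N` Gamma laws with
shape `γ` and scale `1`, i.e. with density `x ^ (γ - 1) * exp (-x) / Γ(γ)` on `[0, ∞)`. -/
noncomputable def productLaw (γ : ℝ) (N : ℕ) : Measure (Fin N → ℝ) :=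
  Measure.pi fun _ => gammaMeasure γ 1

/-- The law `ν_{N,ω}` of `N` independent Gamma(γ) energies conditioned on total energy `ω`.
For Gamma variables the normalised configuration `η / ∑ i, η i` is independent of the total energy,
so this conditional law is the law of `ω • (η / ∑ i, η i)`. That it is the conditional law is
proved below: `condLaw_sum_eq`, `condLaw_disintegration` and `condLaw_continuous` say that it
lives on `{∑ i, η i = ω}`, that it disintegrates the product law along the total energy, and that
it is the version of the disintegration depending continuously on `ω`. -/
noncomputable def condLaw (γ : ℝ) (N : ℕ) (ω : ℝ) : Measure (Fin N → ℝ) :=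
  (productLaw γ N).map fun η => (ω / ∑ i, η i) • η

section ConditionalLaw

theorem isProbabilityMeasure_productLaw {γ : ℝ} (hγ : 0 < γ) (N : ℕ) :
    IsProbabilityMeasure (productLaw γ N) := by
  have := isProbabilityMeasure_gammaMeasure hγ one_pos
  unfold productLaw; infer_instance

theorem measurable_rescale (N : ℕ) (ω : ℝ) :
    Measurable fun η : Fin N → ℝ => (ω / ∑ i, η i) • η := by
  fun_prop

theorem isProbabilityMeasure_condLaw {γ : ℝ} (hγ : 0 < γ) (N : ℕ) (ω : ℝ) :
    IsProbabilityMeasure (condLaw γ N ω) := by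
  have := isProbabilityMeasure_productLaw hγ N
  exact Measure.isProbabilityMeasure_map (measurable_rescale N ω).aemeasurable

theorem gamma_pos_ae (γ : ℝ) : ∀ᵐ x ∂(gammaMeasure γ 1), 0 < x := by
  have h0 : ∀ᵐ x ∂(gammaMeasure γ 1), x ≠ 0 :=
    (withDensity_absolutelyContinuous _ _).ae_le (Measure.ae_ne volume 0)
  have h1 : ∀ᵐ x ∂(gammaMeasure γ 1), 0 ≤ x := by
    unfold gammaMeasure
    rw [ae_withDensity_iff (by unfold gammaPDF; fun_prop)]
    filter_upwards with x hx
    by_contra h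
    exact hx (gammaPDF_of_neg (not_le.1 h))
  filter_upwards [h0, h1] with x hx hx' using lt_of_le_of_ne hx' hx.symm

theorem productLaw_pos_ae {γ : ℝ} (hγ : 0 < γ) (N : ℕ) :
    ∀ᵐ η ∂(productLaw γ N), ∀ i, 0 < η i := by
  have := isProbabilityMeasure_gammaMeasure hγ one_pos
  rw [Filter.eventually_all]
  intro i
  exact (measurePreserving_eval (fun _ : Fin N => gammaMeasure γ 1) i).quasiMeasurePreserving.ae
    (gamma_pos_ae γ)

theorem productLaw_sum_pos_ae {γ : ℝ} (hγ : 0 < γ) {N : ℕ} (hN : 1 ≤ N) :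
    ∀ᵐ η ∂(productLaw γ N), 0 < ∑ i, η i := by
  filter_upwards [productLaw_pos_ae hγ N] with η hη
  exact Finset.sum_pos (fun i _ => hη i) ⟨⟨0, hN⟩, Finset.mem_univ _⟩

/-- The conditional law lives on nonnegative configurations of total energy `ω`. -/
theorem condLaw_sum_eq {γ : ℝ} (hγ : 0 < γ) {N : ℕ} (hN : 1 ≤ N) {ω : ℝ} (hω : 0 ≤ ω) :
    ∀ᵐ η ∂(condLaw γ N ω), (∀ i, 0 ≤ η i) ∧ ∑ i, η i = ω := by
  have hm : MeasurableSet {η : Fin N → ℝ | (∀ i, 0 ≤ η i) ∧ ∑ i, η i = ω} := by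
    measurability
  rw [condLaw, ae_map_iff (measurable_rescale N ω).aemeasurable hm]
  filter_upwards [productLaw_pos_ae hγ N, productLaw_sum_pos_ae hγ hN] with η h1 h2
  refine ⟨fun i => mul_nonneg (div_nonneg hω h2.le) (h1 i).le, ?_⟩
  simp only [Pi.smul_apply, smul_eq_mul, ← Finset.mul_sum]
  field_simp

/-- The conditional law depends continuously on `ω`, in the weak sense. -/
theorem condLaw_continuous {γ : ℝ} (hγ : 0 < γ) (N : ℕ)
    (f : BoundedContinuousFunction (Fin N → ℝ) ℝ) :
    Continuous fun ω => ∫ η, f η ∂(condLaw γ N ω) := by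
  have := isProbabilityMeasure_productLaw hγ N
  have h : ∀ ω, ∫ η, f η ∂(condLaw γ N ω) = ∫ η, f ((ω / ∑ i, η i) • η) ∂(productLaw γ N) :=
    fun ω => integral_map (measurable_rescale N ω).aemeasurable
      f.continuous.measurable.aestronglyMeasurable
  simp only [h]
  refine continuous_of_dominated (bound := fun _ => ‖f‖) (fun ω => ?_) (fun ω => ?_)
    (integrable_const _) ?_
  · exact (f.continuous.measurable.comp (measurable_rescale N ω)).aestronglyMeasurable
  · exact Filter.Eventually.of_forall fun η => f.norm_coe_le_norm _
  · exact Filter.Eventually.of_forall fun η => by fun_prop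

theorem lintegral_prod_productLaw {γ : ℝ} (hγ : 0 < γ) (N : ℕ) (u : Fin N → ℝ → ℝ≥0∞)
    (hu : ∀ i, Measurable (u i)) :
    ∫⁻ η, ∏ i, u i (η i) ∂(productLaw γ N) = ∏ i, ∫⁻ x, u i x ∂(gammaMeasure γ 1) := by
  have := isProbabilityMeasure_gammaMeasure hγ one_pos
  have hind : iIndepFun (fun i (η : Fin N → ℝ) => u i (η i)) (productLaw γ N) :=
    iIndepFun_pi (μ := fun _ : Fin N => gammaMeasure γ 1) (fun i => (hu i).aemeasurable)
  rw [lintegral_prod_eq_prod_lintegral_of_indepFun _ _ hind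
    (fun i => (hu i).comp (measurable_pi_apply i))]
  refine Finset.prod_congr rfl fun i _ => ?_
  exact (measurePreserving_eval (fun _ : Fin N => gammaMeasure γ 1) i).lintegral_comp (hu i)

/-- Effect of a change of scale on one Gamma variable. -/
theorem gamma_scale {γ : ℝ} {s : ℝ} (hs : 0 < s) (g : ℝ → ℝ≥0∞) (hg : Measurable g) :
    ∫⁻ x, g x ∂(gammaMeasure γ 1) = ∫⁻ x, ENNReal.ofReal (s ^ γ * Real.exp ((1 - s) * x)) * g (s * x)
      ∂(gammaMeasure γ 1) := by
  have hp : Measurable (gammaPDF γ 1) := by unfold gammaPDF; fun_prop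
  unfold gammaMeasure
  rw [lintegral_withDensity_eq_lintegral_mul _ hp hg,
    lintegral_withDensity_eq_lintegral_mul _ hp (by fun_prop)]
  have key : ∫⁻ x, (gammaPDF γ 1 * g) x
      = ENNReal.ofReal s * ∫⁻ x, (gammaPDF γ 1 * g) (s * x) := by
    have h2 := Measure.map_addHaar_smul (volume : Measure ℝ) hs.ne'
    have h3 : ∫⁻ x, (gammaPDF γ 1 * g) (s * x)
        = ∫⁻ x, (gammaPDF γ 1 * g) x ∂(Measure.map (s • ·) volume) :=
      (lintegral_map (hp.mul hg) (by fun_prop)).symm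
    rw [h3, h2, lintegral_smul_measure, smul_eq_mul, ← mul_assoc, ← ENNReal.ofReal_mul hs.le]
    simp [abs_of_pos hs, hs.ne']
  have hc : Measurable fun x => (gammaPDF γ 1 * g) (s * x) :=
    (hp.mul hg).comp (measurable_const_mul s)
  rw [key, ← lintegral_const_mul _ hc]
  refine lintegral_congr fun x => ?_
  simp only [Pi.mul_apply]
  rw [← mul_assoc, ← mul_assoc]
  congr 1
  rcases lt_or_ge x 0 with hx | hx
  · rw [gammaPDF_of_neg hx, gammaPDF_of_neg (mul_neg_of_pos_of_neg hs hx)]; simp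
  · rw [gammaPDF_of_nonneg hx, gammaPDF_of_nonneg (mul_nonneg hs.le hx), ← ENNReal.ofReal_mul hs.le,
      mul_comm (ENNReal.ofReal _) (ENNReal.ofReal (s ^ γ * _)), ← ENNReal.ofReal_mul (by positivity)]
    congr 1
    rw [Real.mul_rpow hs.le hx, Real.rpow_sub_one hs.ne']
    have : Real.exp (-(1 * (s * x))) = Real.exp ((1 - s) * x) * Real.exp (-(1 * x)) := by
      rw [← Real.exp_add]; congr 1; ring
    rw [this]
    field_simp

/-- Effect of a change of scale on the product law. -/
theorem productLaw_scale {γ : ℝ} (hγ : 0 < γ) (N : ℕ) {s : ℝ} (hs : 0 < s)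
    (g : (Fin N → ℝ) → ℝ≥0∞) (hg : Measurable g) :
    ∫⁻ η, g η ∂(productLaw γ N) =
      ∫⁻ η, ENNReal.ofReal ((s ^ γ) ^ N * Real.exp ((1 - s) * ∑ i, η i)) * g (s • η)
        ∂(productLaw γ N) := by
  have hG := isProbabilityMeasure_gammaMeasure hγ one_pos
  set w : (Fin N → ℝ) → ℝ≥0∞ := fun η =>
    ENNReal.ofReal ((s ^ γ) ^ N * Real.exp ((1 - s) * ∑ i, η i)) with hw
  have hwm : Measurable w := by fun_prop
  have hsm : Measurable fun η : Fin N → ℝ => s • η := by fun_prop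
  have hwp : ∀ η, w η = ∏ i, ENNReal.ofReal (s ^ γ * Real.exp ((1 - s) * η i)) := by
    intro η
    rw [← ENNReal.ofReal_prod_of_nonneg (fun i _ => by positivity), Finset.prod_mul_distrib]
    simp only [hw]
    rw [Finset.mul_sum, Real.exp_sum]
    simp
  have key : productLaw γ N = ((productLaw γ N).withDensity w).map (s • ·) := by
    refine Measure.pi_eq (μ := fun _ : Fin N => gammaMeasure γ 1) fun t ht => ?_
    rw [Measure.map_apply hsm (MeasurableSet.univ_pi ht),
      withDensity_apply _ (hsm (MeasurableSet.univ_pi ht)),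
      ← lintegral_indicator (hsm (MeasurableSet.univ_pi ht))]
    have : ∀ η, ((s • ·) ⁻¹' Set.univ.pi t).indicator w η
        = ∏ i, (ENNReal.ofReal (s ^ γ * Real.exp ((1 - s) * η i)) *
            (t i).indicator 1 (s * η i)) := by
      intro η
      rw [Finset.prod_mul_distrib, ← hwp]
      by_cases h : s • η ∈ Set.univ.pi t
      · rw [Set.indicator_of_mem (by exact h), Finset.prod_eq_one, mul_one]
        intro i _
        exact Set.indicator_of_mem (h i (Set.mem_univ i)) _
      · rw [Set.indicator_of_notMem (by exact h)]
        simp only [Set.mem_pi, Set.mem_univ, true_imp_iff, not_forall] at h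
        obtain ⟨i, hi⟩ := h
        rw [Finset.prod_eq_zero (Finset.mem_univ i), mul_zero]
        exact Set.indicator_of_notMem hi _
    rw [lintegral_congr this, lintegral_prod_productLaw hγ N
      (fun i x => ENNReal.ofReal (s ^ γ * Real.exp ((1 - s) * x)) * (t i).indicator 1 (s * x))]
    · refine Finset.prod_congr rfl fun i _ => ?_
      rw [← gamma_scale hs _ (measurable_one.indicator (ht i)), lintegral_indicator_one (ht i)]
    · intro i
      have := (measurable_one.indicator (ht i) : Measurable ((t i).indicator (1 : ℝ → ℝ≥0∞)))
      fun_prop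
  conv_lhs => rw [key]
  have hc : Measurable fun η : Fin N → ℝ => g (s • η) := hg.comp hsm
  rw [lintegral_map hg hsm, lintegral_withDensity_eq_lintegral_mul _ hwm hc]
  rfl

/-- Scale invariance of `ds / s` on `(0, ∞)`. -/
theorem haar_scale {c : ℝ} (hc : 0 < c) (φ : ℝ → ℝ≥0∞) (hφ : Measurable φ) :
    ∫⁻ s in Set.Ioi (0 : ℝ), ENNReal.ofReal s⁻¹ * φ (c * s)
      = ∫⁻ s in Set.Ioi (0 : ℝ), ENNReal.ofReal s⁻¹ * φ s := by
  set F : ℝ → ℝ≥0∞ := (Set.Ioi (0 : ℝ)).indicator fun s => ENNReal.ofReal s⁻¹ * φ s with hF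
  have hFm : Measurable F := Measurable.indicator (by fun_prop) measurableSet_Ioi
  rw [← lintegral_indicator measurableSet_Ioi, ← lintegral_indicator measurableSet_Ioi]
  have h1 : ∀ s, (Set.Ioi (0 : ℝ)).indicator (fun s => ENNReal.ofReal s⁻¹ * φ (c * s)) s
      = ENNReal.ofReal c * F (c * s) := by
    intro s
    by_cases h : 0 < s
    · rw [Set.indicator_of_mem (by exact h), hF, Set.indicator_of_mem (by exact mul_pos hc h),
        ← mul_assoc, ← ENNReal.ofReal_mul hc.le]
      congr 2
      field_simp
    · rw [Set.indicator_of_notMem (by exact h), hF, Set.indicator_of_notMem, mul_zero]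
      simp only [Set.mem_Ioi, not_lt] at h ⊢
      exact mul_nonpos_of_nonneg_of_nonpos hc.le h
  have h3 : ∫⁻ x, F (c * x) = ∫⁻ x, F x ∂(Measure.map (c • ·) volume) :=
    (lintegral_map hFm (by fun_prop)).symm
  have hc' : Measurable fun x => F (c * x) := hFm.comp (measurable_const_mul c)
  rw [lintegral_congr h1, lintegral_const_mul _ hc', h3,
    Measure.map_addHaar_smul (volume : Measure ℝ) hc.ne', lintegral_smul_measure, smul_eq_mul,
    ← mul_assoc, ← ENNReal.ofReal_mul hc.le]
  simp [abs_of_pos hc, hc.ne', hF]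

/-- The total energy and the normalised configuration are independent. -/
theorem productLaw_indep {γ : ℝ} (hγ : 0 < γ) {N : ℕ} (hN : 1 ≤ N)
    (φ : ℝ → ℝ≥0∞) (hφ : Measurable φ) (h : (Fin N → ℝ) → ℝ≥0∞) (hh : Measurable h) :
    ∫⁻ η, φ (∑ i, η i) * h ((∑ i, η i)⁻¹ • η) ∂(productLaw γ N)
      = (∫⁻ η, φ (∑ i, η i) ∂(productLaw γ N)) *
        ∫⁻ η, h ((∑ i, η i)⁻¹ • η) ∂(productLaw γ N) := by
  have hP := isProbabilityMeasure_productLaw hγ N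
  set ψ : ℝ → ℝ≥0∞ := (Set.Ico (1 : ℝ) 2).indicator 1 with hψ
  have hψm : Measurable ψ := measurable_one.indicator measurableSet_Ico
  set K : ℝ≥0∞ := ∫⁻ s in Set.Ioi (0 : ℝ), ENNReal.ofReal s⁻¹ * ψ s⁻¹ with hK
  set Φ : (ℝ → ℝ≥0∞) → ℝ≥0∞ := fun φ => ∫⁻ s in Set.Ioi (0 : ℝ),
    ENNReal.ofReal s⁻¹ * (ENNReal.ofReal ((s ^ γ) ^ N * Real.exp (-s)) * φ s) with hΦ
  set B : ((Fin N → ℝ) → ℝ≥0∞) → ℝ≥0∞ := fun h => ∫⁻ η,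
    ENNReal.ofReal ((((∑ i, η i) ^ γ) ^ N)⁻¹ * Real.exp (∑ i, η i)) * ψ (∑ i, η i) *
      h ((∑ i, η i)⁻¹ • η) ∂(productLaw γ N) with hB
  have main : ∀ (φ : ℝ → ℝ≥0∞), Measurable φ → ∀ h : (Fin N → ℝ) → ℝ≥0∞, Measurable h →
      K * ∫⁻ η, φ (∑ i, η i) * h ((∑ i, η i)⁻¹ • η) ∂(productLaw γ N) = B h * Φ φ := by
    intro φ hφ h hh
    have hm1 : Measurable fun η : Fin N → ℝ => φ (∑ i, η i) * h ((∑ i, η i)⁻¹ • η) := by fun_prop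
    have e1 : K * ∫⁻ η, φ (∑ i, η i) * h ((∑ i, η i)⁻¹ • η) ∂(productLaw γ N)
        = ∫⁻ η, (∫⁻ s in Set.Ioi (0 : ℝ), ENNReal.ofReal s⁻¹ * ψ (s⁻¹ * ∑ i, η i) *
            (φ (∑ i, η i) * h ((∑ i, η i)⁻¹ • η))) ∂(productLaw γ N) := by
      rw [← lintegral_const_mul _ hm1]
      refine lintegral_congr_ae ?_
      filter_upwards [productLaw_sum_pos_ae hγ hN] with η hη
      rw [lintegral_mul_const _ (by fun_prop), hK,
        ← haar_scale (inv_pos.2 hη) (fun s => ψ s⁻¹) (by fun_prop)]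
      simp only [mul_inv, inv_inv, mul_comm (∑ i, η i)]
    rw [e1, lintegral_lintegral_swap (by fun_prop)]
    have e2 : ∀ s ∈ Set.Ioi (0 : ℝ),
        ∫⁻ η, ENNReal.ofReal s⁻¹ * ψ (s⁻¹ * ∑ i, η i) *
            (φ (∑ i, η i) * h ((∑ i, η i)⁻¹ • η)) ∂(productLaw γ N)
        = ∫⁻ η, ENNReal.ofReal s⁻¹ * (ENNReal.ofReal ((s ^ γ) ^ N * Real.exp ((1 - s) * ∑ i, η i)) *
            (ψ (∑ i, η i) * (φ ((∑ i, η i) * s) * h ((∑ i, η i)⁻¹ • η)))) ∂(productLaw γ N) := by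
      intro s hs
      have hs' : s ≠ 0 := (Set.mem_Ioi.1 hs).ne'
      rw [productLaw_scale hγ N hs _ (by fun_prop)]
      refine lintegral_congr fun η => ?_
      have a1 : ∑ i, (s • η) i = (∑ i, η i) * s := by
        simp [← Finset.mul_sum, mul_comm]
      have a2 : s⁻¹ * ((∑ i, η i) * s) = ∑ i, η i := by field_simp
      have a3 : ((∑ i, η i) * s)⁻¹ • s • η = (∑ i, η i)⁻¹ • η := by
        rw [smul_smul, mul_inv, mul_assoc, inv_mul_cancel₀ hs', mul_one]
      rw [a1, a2, a3]
      ring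
    rw [setLIntegral_congr_fun measurableSet_Ioi e2, lintegral_lintegral_swap (by fun_prop), hB,
      ← lintegral_mul_const _ (by fun_prop)]
    refine lintegral_congr_ae ?_
    filter_upwards [productLaw_sum_pos_ae hγ hN] with η hη
    have hη' := hη.ne'
    have e3 : Φ φ = ∫⁻ s in Set.Ioi (0 : ℝ), ENNReal.ofReal s⁻¹ *
        (ENNReal.ofReal ((((∑ i, η i) * s) ^ γ) ^ N * Real.exp (-((∑ i, η i) * s))) *
          φ ((∑ i, η i) * s)) :=
      (haar_scale hη (fun s => ENNReal.ofReal ((s ^ γ) ^ N * Real.exp (-s)) * φ s)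
        (by fun_prop)).symm
    rw [e3, ← lintegral_const_mul _ (by fun_prop)]
    refine setLIntegral_congr_fun measurableSet_Ioi fun s hs => ?_
    have hs' : 0 < s := hs
    have a4 : ENNReal.ofReal ((s ^ γ) ^ N * Real.exp ((1 - s) * ∑ i, η i))
        = ENNReal.ofReal ((((∑ i, η i) ^ γ) ^ N)⁻¹ * Real.exp (∑ i, η i)) *
          ENNReal.ofReal ((((∑ i, η i) * s) ^ γ) ^ N * Real.exp (-((∑ i, η i) * s))) := by
      rw [← ENNReal.ofReal_mul (by positivity)]
      congr 1
      have : Real.exp ((1 - s) * ∑ i, η i)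
          = Real.exp (∑ i, η i) * Real.exp (-((∑ i, η i) * s)) := by
        rw [← Real.exp_add]; congr 1; ring
      rw [this, Real.mul_rpow hη.le hs'.le, mul_pow]
      have : ((∑ i, η i) ^ γ) ^ N ≠ 0 := by positivity
      field_simp
    simp only [a4]
    ring
  have hψ1 : ∀ s ∈ Set.Ioi (0 : ℝ), ENNReal.ofReal s⁻¹ * ψ s⁻¹
      = (Set.Ioc (1 / 2 : ℝ) 1).indicator (fun s => ENNReal.ofReal s⁻¹) s := by
    intro s hs
    have hs' : 0 < s := hs
    have : s⁻¹ ∈ Set.Ico (1 : ℝ) 2 ↔ s ∈ Set.Ioc (1 / 2 : ℝ) 1 := by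
      rw [Set.mem_Ico, Set.mem_Ioc, one_le_inv₀ hs', inv_lt_comm₀ hs' two_pos, one_div]
      tauto
    by_cases hx : s ∈ Set.Ioc (1 / 2 : ℝ) 1
    · rw [Set.indicator_of_mem hx, hψ, Set.indicator_of_mem (this.2 hx), Pi.one_apply, mul_one]
    · rw [Set.indicator_of_notMem hx, hψ, Set.indicator_of_notMem (fun hc => hx (this.1 hc)),
        mul_zero]
  have hK' : K = ∫⁻ s in Set.Ioc (1 / 2 : ℝ) 1, ENNReal.ofReal s⁻¹ := by
    rw [hK, setLIntegral_congr_fun measurableSet_Ioi hψ1, setLIntegral_indicator measurableSet_Ioc]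
    congr 2
    ext x; simp only [Set.mem_inter_iff, Set.mem_Ioc, Set.mem_Ioi]
    constructor
    · exact fun h => h.1
    · exact fun h => ⟨h, by linarith [h.1]⟩
  have hKtop : K ≠ ⊤ := by
    rw [hK']
    refine (lt_of_le_of_lt (setLIntegral_mono (g := fun _ => 2) measurable_const fun s hs => ?_)
      (by simp [ENNReal.mul_lt_top_iff])).ne
    rw [show (2 : ℝ≥0∞) = ENNReal.ofReal 2 by simp]
    refine ENNReal.ofReal_le_ofReal ?_
    rw [inv_le_comm₀ (by linarith [hs.1]) two_pos]
    linarith [hs.1]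
  have hK0 : K ≠ 0 := by
    rw [hK']
    have : ∫⁻ _ in Set.Ioc (1 / 2 : ℝ) 1, (1 : ℝ≥0∞) ≤
        ∫⁻ s in Set.Ioc (1 / 2 : ℝ) 1, ENNReal.ofReal s⁻¹ := by
      refine setLIntegral_mono (by fun_prop) fun s hs => ?_
      rw [← ENNReal.ofReal_one]
      exact ENNReal.ofReal_le_ofReal ((one_le_inv₀ (by linarith [hs.1])).2 hs.2)
    refine (lt_of_lt_of_le ?_ this).ne'
    simp
    norm_num
  have m1 := main φ hφ h hh
  have m2 := main φ hφ (fun _ => 1) measurable_const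
  have m3 := main (fun _ => 1) measurable_const h hh
  have m4 := main (fun _ => 1) measurable_const (fun _ => 1) measurable_const
  simp only [mul_one, one_mul, lintegral_const, measure_univ] at m2 m3 m4
  have : K * (K * ∫⁻ η, φ (∑ i, η i) * h ((∑ i, η i)⁻¹ • η) ∂(productLaw γ N))
      = K * (K * ((∫⁻ η, φ (∑ i, η i) ∂(productLaw γ N)) *
        ∫⁻ η, h ((∑ i, η i)⁻¹ • η) ∂(productLaw γ N))) := by
    rw [m1]
    calc K * (B h * Φ φ) = (B (fun _ => 1) * Φ (fun _ => 1)) * (B h * Φ φ) := by rw [← m4]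
      _ = (B (fun _ => 1) * Φ φ) * (B h * Φ (fun _ => 1)) := by ring
      _ = _ := by rw [← m2, ← m3]; ring
  exact (ENNReal.mul_right_inj hK0 hKtop).1 ((ENNReal.mul_right_inj hK0 hKtop).1 this)

/-- The laws `condLaw γ N ω` disintegrate the product law along the total energy. -/
theorem condLaw_disintegration {γ : ℝ} (hγ : 0 < γ) {N : ℕ} (hN : 1 ≤ N)
    {A : Set (Fin N → ℝ)} (hA : MeasurableSet A) {E : Set ℝ} (hE : MeasurableSet E) :
    productLaw γ N (A ∩ {η | ∑ i, η i ∈ E}) =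
      ∫⁻ ω in E, condLaw γ N ω A ∂((productLaw γ N).map fun η => ∑ i, η i) := by
  have hP := isProbabilityMeasure_productLaw hγ N
  have hS : Measurable fun η : Fin N → ℝ => ∑ i, η i := by fun_prop
  have hU : Measurable fun η : Fin N → ℝ => (∑ i, η i)⁻¹ • η := by fun_prop
  have hjoint : (productLaw γ N).map (fun η => (∑ i, η i, (∑ i, η i)⁻¹ • η)) =
      ((productLaw γ N).map fun η => ∑ i, η i).prod
        ((productLaw γ N).map fun η => (∑ i, η i)⁻¹ • η) := by
    have := Measure.isProbabilityMeasure_map (μ := productLaw γ N) hS.aemeasurable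
    have := Measure.isProbabilityMeasure_map (μ := productLaw γ N) hU.aemeasurable
    refine (Measure.prod_eq fun s t hs ht => ?_).symm
    have hi := productLaw_indep hγ hN (s.indicator 1) (measurable_one.indicator hs)
      (t.indicator 1) (measurable_one.indicator ht)
    rw [← lintegral_map (measurable_one.indicator hs) hS,
      ← lintegral_map (measurable_one.indicator ht) hU, lintegral_indicator_one hs,
      lintegral_indicator_one ht] at hi
    rw [← hi, ← lintegral_indicator_one (hs.prod ht),
      lintegral_map (measurable_one.indicator (hs.prod ht)) (hS.prodMk hU)]
    refine lintegral_congr fun η => ?_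
    simp only [Set.indicator, Set.mem_prod, Pi.one_apply]
    split_ifs <;> simp_all
  have hT : Measurable fun q : ℝ × (Fin N → ℝ) => q.1 • q.2 := by fun_prop
  set G : ℝ × (Fin N → ℝ) → ℝ≥0∞ :=
    ((Prod.fst ⁻¹' E) ∩ ((fun q : ℝ × (Fin N → ℝ) => q.1 • q.2) ⁻¹' A)).indicator 1 with hG
  have hGs : MeasurableSet
      ((Prod.fst ⁻¹' E) ∩ ((fun q : ℝ × (Fin N → ℝ) => q.1 • q.2) ⁻¹' A)) :=
    (measurable_fst hE).inter (hT hA)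
  have hGm : Measurable G := measurable_one.indicator hGs
  have hL : productLaw γ N (A ∩ {η | ∑ i, η i ∈ E}) =
      ∫⁻ q, G q ∂((productLaw γ N).map (fun η => (∑ i, η i, (∑ i, η i)⁻¹ • η))) := by
    rw [lintegral_map hGm (hS.prodMk hU), 
      ← lintegral_indicator_one (show MeasurableSet (A ∩ {η | ∑ i, η i ∈ E}) from hA.inter (hS hE))]
    refine lintegral_congr_ae ?_
    filter_upwards [productLaw_sum_pos_ae hγ hN] with η hη
    have hiff : (∑ i, η i, (∑ i, η i)⁻¹ • η) ∈
        (Prod.fst ⁻¹' E) ∩ ((fun q : ℝ × (Fin N → ℝ) => q.1 • q.2) ⁻¹' A) ↔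
        η ∈ A ∩ {η | ∑ i, η i ∈ E} := by
      simp only [Set.mem_inter_iff, Set.mem_preimage, smul_smul, mul_inv_cancel₀ hη.ne', one_smul]
      exact and_comm
    by_cases h : η ∈ A ∩ {η | ∑ i, η i ∈ E}
    · rw [Set.indicator_of_mem h, hG, Set.indicator_of_mem (hiff.2 h)]; rfl
    · rw [Set.indicator_of_notMem h, hG, Set.indicator_of_notMem (fun h' => h (hiff.1 h'))]
  rw [hL, hjoint, lintegral_prod _ hGm.aemeasurable, ← lintegral_indicator hE]
  refine lintegral_congr fun ω => ?_
  by_cases hω : ω ∈ E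
  · have hm : Measurable fun u : Fin N → ℝ => G (ω, u) := hGm.comp measurable_prodMk_left
    rw [Set.indicator_of_mem hω, lintegral_map hm hU, condLaw,
      Measure.map_apply (measurable_rescale N ω) hA,
      ← lintegral_indicator_one (measurable_rescale N ω hA)]
    refine lintegral_congr fun η => ?_
    have hiff : (ω, (∑ i, η i)⁻¹ • η) ∈
        (Prod.fst ⁻¹' E) ∩ ((fun q : ℝ × (Fin N → ℝ) => q.1 • q.2) ⁻¹' A) ↔
        η ∈ (fun η : Fin N → ℝ => (ω / ∑ i, η i) • η) ⁻¹' A := by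
      simp only [Set.mem_inter_iff, Set.mem_preimage, hω, true_and, smul_smul, div_eq_mul_inv]
    by_cases h : η ∈ (fun η : Fin N → ℝ => (ω / ∑ i, η i) • η) ⁻¹' A
    · rw [Set.indicator_of_mem h, hG, Set.indicator_of_mem (hiff.2 h)]; rfl
    · rw [Set.indicator_of_notMem h, hG, Set.indicator_of_notMem (fun h' => h (hiff.1 h'))]
  · rw [Set.indicator_of_notMem hω]
    have : ∀ u, G (ω, u) = 0 := fun u => Set.indicator_of_notMem (fun h => hω h.1) _
    simp [this]

end ConditionalLaw

/-- The `σ`-algebra generated by the coordinates `η k` with `k ≠ i, j`. -/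
abbrev pairComplement {N : ℕ} (i j : Fin N) : MeasurableSpace (Fin N → ℝ) :=
  MeasurableSpace.comap (fun (η : Fin N → ℝ) (k : {k : Fin N // k ≠ i ∧ k ≠ j}) => η k)
    inferInstance

/-- The generator `L* f = (1/N) ∑_{i<j} (ν[f | η k, k ≠ i, j] - f)` of the binary collision process
given by simple averages. -/
noncomputable def averageGenerator {N : ℕ} (ν : Measure (Fin N → ℝ)) (f : (Fin N → ℝ) → ℝ) :
    (Fin N → ℝ) → ℝ := fun η =>
  (1 / (N : ℝ)) * ∑ p : Fin N × Fin N with p.1 < p.2, ((ν[f | pairComplement p.1 p.2]) η - f η)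

/-- The collision at the pair `i, j`: the total energy `η i + η j` of the pair is split into
`a * (η i + η j)` at `i` and `(1 - a) * (η i + η j)` at `j`, all other energies are kept. -/
def exchange {N : ℕ} (i j : Fin N) (a : ℝ) (η : Fin N → ℝ) : Fin N → ℝ :=
  Function.update (Function.update η i (a * (η i + η j))) j ((1 - a) * (η i + η j))

/-- The generator of the energy exchange process on the complete graph in which every pair collides
at rate `1/N` and the fraction of energy given to the first site of the pair is drawn from
the Beta(γ, γ) law. -/
noncomputable def exchangeGenerator {N : ℕ} (γ : ℝ) (f : (Fin N → ℝ) → ℝ) :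
    (Fin N → ℝ) → ℝ := fun η =>
  (1 / (N : ℝ)) * ∑ p : Fin N × Fin N with p.1 < p.2,
    ∫ a, (f (exchange p.1 p.2 a η) - f η) ∂(betaMeasure γ γ)

/-- The spectral gap of `-L` in `L²(ν)`: the infimum of `ν(f (-L f)) / ν(f²)` over the nonzero
`f ∈ L²(ν)` with `ν(f) = 0`. It is `⊤` if there is no such `f`, i.e. if `ν` is a Dirac mass. -/
noncomputable def spectralGap {Ω : Type*} [MeasurableSpace Ω] (ν : Measure Ω)
    (L : (Ω → ℝ) → (Ω → ℝ)) : EReal :=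
  ⨅ (f : Ω → ℝ) (_ : MemLp f 2 ν ∧ ∫ η, f η ∂ν = 0 ∧ ∫ η, f η ^ 2 ∂ν ≠ 0),
    (((∫ η, f η * (-(L f η)) ∂ν) / (∫ η, f η ^ 2 ∂ν) : ℝ) : EReal)

/-- `λ*(N, ω)`: the spectral gap of the simple average process at total energy `ω`. -/
noncomputable def gapAt (γ : ℝ) (N : ℕ) (ω : ℝ) : EReal :=
  spectralGap (condLaw γ N ω) (averageGenerator (condLaw γ N ω))

/-- `λ*(N)`: the infimum of `λ*(N, ω)` over all total energies `ω > 0`. -/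
noncomputable def gap (γ : ℝ) (N : ℕ) : EReal :=
  ⨅ (ω : ℝ) (_ : 0 < ω), gapAt γ N ω

end EnergyExchange

/-! The collision average of a pair resamples the two energies given their sum, and Beta(`γ`, `γ`)
splitting is exactly the conditional law of two Gamma(`γ`) energies given their sum
(`lintegral_gamma_pair`). Hence a collision preserves the conditional law
(`measurePreserving_exchange`) and equals the conditional expectation given the other energies
(`collide_ae_eq_condExp`), because on the energy simplex the pair energy is a function of these.
This identifies the two generators.

For the gap, let `R` be the sum over all pairs of the collision averages, `M` the number of pairs and
`c = (γ N + 1) / (2 γ + 1)`, so that the claim is that the quadratic form of `R` is at most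
`M - c` on mean zero observables, sharply. Averaging `∑ k, z k ^ 2` over the collisions of a vector
`z` with `∑ k, z k = 0` multiplies it by `M - c` when summed over pairs (`collideSum_sum_sq`). Two
consequences follow.

* `∑ k, η k ^ 2`, centred, is an eigenfunction of `R` with eigenvalue `M - c`, which gives the upper
  bound on the gap.
* As collisions act linearly on configurations, a bound on the tangential Hessian of an observable
  is multiplied by `M - c` under `R` (`HessianBound.collideSum`). By Jensen's inequality such a bound
  controls the distance to the linear observables (`HessianBound.abs_sub_interpolation_le`). So on
  the orthogonal complement of the linear observables, which `R` preserves, the powers `R ^ n`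
  decay like `(M - c) ^ n` along every observable with a Hessian bound. As `R` is symmetric,
  log-convexity of `‖R ^ n h‖` turns this into `‖R h‖ ≤ (M - c) ‖h‖`
  (`norm_apply_le_of_norm_pow_le`), and density of these observables (`dense_hessianBounded`)
  extends it to the whole complement. On mean zero linear observables `R` is multiplication by
  `M - N / 2 ≤ M - c` (`collisionOperator_linearObservable`).
-/

namespace EnergyExchange

open MeasureTheory ProbabilityTheory
open scoped ENNReal

/-! ### The Gamma law and Beta collisions -/

/-- The density of the total energy of two independent Gamma(`γ`) energies, with the normalising
constant `1 / Γ(2γ)` written as `B(γ, γ) / Γ(γ) ^ 2`. -/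
noncomputable def pairEnergyDensity (γ s : ℝ) : ℝ :=
  if 0 < s then beta γ γ / Real.Gamma γ ^ 2 * s ^ (2 * γ - 1) * Real.exp (-s) else 0

theorem measurable_betaPDF (a b : ℝ) : Measurable (betaPDF a b) :=
  (measurable_betaPDFReal a b).ennreal_ofReal

theorem measurable_gammaPDF (a r : ℝ) : Measurable (gammaPDF a r) :=
  (measurable_gammaPDFReal a r).ennreal_ofReal

theorem gammaPDF_mul_gammaPDF {γ : ℝ} (hγ : 0 < γ) {s a : ℝ} (hs : 0 < s) (h0 : a ≠ 0)
    (h1 : a ≠ 1) :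
    ENNReal.ofReal s * (gammaPDF γ 1 (s * a) * gammaPDF γ 1 (s - s * a)) =
      ENNReal.ofReal (pairEnergyDensity γ s) * betaPDF γ γ a := by
  rcases lt_or_gt_of_ne h0 with h | h
  · rw [gammaPDF_of_neg (mul_neg_of_pos_of_neg hs h), betaPDF_eq_zero_of_nonpos h.le]; simp
  rcases lt_or_gt_of_ne h1 with h' | h'
  · have hG := Real.Gamma_pos_of_pos hγ
    have hB := beta_pos hγ hγ
    have hsa : s - s * a = s * (1 - a) := by ring
    have h1a : 0 < 1 - a := by linarith
    rw [hsa, gammaPDF_of_nonneg (by positivity), gammaPDF_of_nonneg (by positivity),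
      betaPDF_of_pos_lt_one h h', ← ENNReal.ofReal_mul (by positivity),
      ← ENNReal.ofReal_mul hs.le, pairEnergyDensity, if_pos hs, ← ENNReal.ofReal_mul (by positivity)]
    congr 1
    rw [Real.mul_rpow hs.le h.le, Real.mul_rpow hs.le h1a.le]
    have e1 : s ^ (2 * γ - 1) = s * (s ^ (γ - 1) * s ^ (γ - 1)) := by
      rw [← Real.rpow_add hs]
      nth_rewrite 2 [← Real.rpow_one s]
      rw [← Real.rpow_add hs]
      congr 1; ring
    have e2 : Real.exp (-s) = Real.exp (-(1 * (s * a))) * Real.exp (-(1 * (s * (1 - a)))) := by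
      rw [← Real.exp_add]; congr 1; ring
    rw [e1, e2, Real.one_rpow]
    field_simp
  · rw [gammaPDF_of_neg (show s - s * a < 0 by nlinarith), betaPDF_eq_zero_of_one_le h'.le]; simp

/-- Two independent Gamma(`γ`) energies are obtained by splitting a random total energy with an
independent Beta(`γ`, `γ`) fraction. -/
theorem lintegral_gamma_pair {γ : ℝ} (hγ : 0 < γ) (F : ℝ × ℝ → ℝ≥0∞) (hF : Measurable F) :
    ∫⁻ x, ∫⁻ y, F (x, y) ∂(gammaMeasure γ 1) ∂(gammaMeasure γ 1) =
      ∫⁻ s, ENNReal.ofReal (pairEnergyDensity γ s) *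
        ∫⁻ a, F (a * s, (1 - a) * s) ∂(betaMeasure γ γ) := by
  have hg := measurable_gammaPDF γ 1
  have hb := measurable_betaPDF γ γ
  have hint : ∀ x, ∫⁻ y, F (x, y) ∂(gammaMeasure γ 1)
      = ∫⁻ s, gammaPDF γ 1 (s - x) * F (x, s - x) := by
    intro x
    rw [gammaMeasure, lintegral_withDensity_eq_lintegral_mul _ hg (by fun_prop)]
    exact (lintegral_sub_right_eq_self (fun y => (gammaPDF γ 1 * fun y => F (x, y)) y) x).symm
  simp only [hint]
  have hm : Measurable fun x => ∫⁻ s, gammaPDF γ 1 (s - x) * F (x, s - x) :=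
    Measurable.lintegral_prod_right' (f := fun q : ℝ × ℝ =>
      gammaPDF γ 1 (q.2 - q.1) * F (q.1, q.2 - q.1)) (by fun_prop)
  rw [gammaMeasure, lintegral_withDensity_eq_lintegral_mul _ hg hm]
  simp only [Pi.mul_apply]
  have e1 : ∀ x, gammaPDF γ 1 x * ∫⁻ s, gammaPDF γ 1 (s - x) * F (x, s - x) =
      ∫⁻ s, gammaPDF γ 1 x * (gammaPDF γ 1 (s - x) * F (x, s - x)) := fun x =>
    (lintegral_const_mul _ (by fun_prop)).symm
  simp only [e1]
  rw [lintegral_lintegral_swap (by fun_prop)]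
  refine lintegral_congr_ae ?_
  filter_upwards [Measure.ae_ne volume (0 : ℝ)] with s hs0
  rcases lt_or_gt_of_ne hs0 with hs | hs
  · rw [pairEnergyDensity, if_neg hs.not_gt]
    simp only [ENNReal.ofReal_zero, zero_mul]
    refine (lintegral_congr fun x => ?_).trans lintegral_zero
    rcases lt_or_ge x 0 with hx | hx
    · rw [gammaPDF_of_neg hx, zero_mul]
    · rw [gammaPDF_of_neg (show s - x < 0 by linarith), zero_mul, mul_zero]
  · set H : ℝ → ℝ≥0∞ := fun x => gammaPDF γ 1 x * (gammaPDF γ 1 (s - x) * F (x, s - x)) with hH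
    have hHm : Measurable H := by fun_prop
    have hscale : ∫⁻ x, H x = ENNReal.ofReal s * ∫⁻ a, H (s * a) := by
      have h3 : ∫⁻ a, H (s * a) = ∫⁻ x, H x ∂(Measure.map (s • ·) volume) :=
        (lintegral_map hHm (by fun_prop)).symm
      rw [h3, Measure.map_addHaar_smul (volume : Measure ℝ) hs.ne', lintegral_smul_measure,
        smul_eq_mul, ← mul_assoc, ← ENNReal.ofReal_mul hs.le]
      simp [abs_of_pos hs, hs.ne']
    rw [hscale, betaMeasure, lintegral_withDensity_eq_lintegral_mul _ hb (by fun_prop),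
      ← lintegral_const_mul _ (by fun_prop), ← lintegral_const_mul _ (by fun_prop)]
    refine lintegral_congr_ae ?_
    filter_upwards [Measure.ae_ne volume (0 : ℝ), Measure.ae_ne volume (1 : ℝ)] with a h0 h1
    have := gammaPDF_mul_gammaPDF hγ hs h0 h1
    simp only [Pi.mul_apply, hH]
    rw [← mul_assoc (ENNReal.ofReal (pairEnergyDensity γ s)), ← this, mul_comm a s,
      show (1 - a) * s = s - s * a by ring]
    ring

/-- A Beta collision leaves the law of two independent Gamma energies invariant. -/
theorem lintegral_gamma_pair_exchange {γ : ℝ} (hγ : 0 < γ) (F : ℝ × ℝ → ℝ≥0∞)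
    (hF : Measurable F) :
    ∫⁻ x, ∫⁻ y, ∫⁻ a, F (a * (x + y), (1 - a) * (x + y)) ∂(betaMeasure γ γ)
        ∂(gammaMeasure γ 1) ∂(gammaMeasure γ 1) =
      ∫⁻ x, ∫⁻ y, F (x, y) ∂(gammaMeasure γ 1) ∂(gammaMeasure γ 1) := by
  have := isProbabilityMeasureBeta hγ hγ
  have hm : Measurable fun q : ℝ × ℝ =>
      ∫⁻ a, F (a * (q.1 + q.2), (1 - a) * (q.1 + q.2)) ∂(betaMeasure γ γ) :=
    Measurable.lintegral_prod_right' (f := fun r : (ℝ × ℝ) × ℝ =>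
      F (r.2 * (r.1.1 + r.1.2), (1 - r.2) * (r.1.1 + r.1.2))) (by fun_prop)
  rw [lintegral_gamma_pair hγ _ hm, lintegral_gamma_pair hγ _ hF]
  refine lintegral_congr fun s => ?_
  have : ∀ b : ℝ, b * s + (1 - b) * s = s := fun b => by ring
  simp only [this, lintegral_const, measure_univ, mul_one]

/-! ### Invariance of the conditional law under collisions -/

theorem exchange_apply_of_ne {N : ℕ} {i j k : Fin N} (hi : k ≠ i) (hj : k ≠ j) (a : ℝ)
    (η : Fin N → ℝ) : exchange i j a η k = η k := by
  simp [exchange, hi, hj]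

theorem exchange_apply_left {N : ℕ} {i j : Fin N} (hij : i ≠ j) (a : ℝ)
    (η : Fin N → ℝ) : exchange i j a η i = a * (η i + η j) := by
  simp [exchange, hij]

theorem exchange_apply_right {N : ℕ} (i j : Fin N) (a : ℝ)
    (η : Fin N → ℝ) : exchange i j a η j = (1 - a) * (η i + η j) := by
  simp [exchange]

theorem exchange_congr {N : ℕ} {i j : Fin N} {η ζ : Fin N → ℝ}
    (h : ∀ k, k ≠ i → k ≠ j → η k = ζ k) (hs : η i + η j = ζ i + ζ j) (a : ℝ) :
    exchange i j a η = exchange i j a ζ := by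
  ext k
  by_cases hj : k = j
  · subst hj; rw [exchange_apply_right, exchange_apply_right, hs]
  by_cases hi : k = i
  · subst hi; rw [exchange_apply_left hj, exchange_apply_left hj, hs]
  · rw [exchange_apply_of_ne hi hj, exchange_apply_of_ne hi hj, h k hi hj]

theorem exchange_add {N : ℕ} {i j : Fin N} (hij : i ≠ j) (a : ℝ) (η ζ : Fin N → ℝ) :
    exchange i j a (η + ζ) = exchange i j a η + exchange i j a ζ := by
  ext k
  by_cases hj : k = j
  · subst hj; simp only [Pi.add_apply, exchange_apply_right]; ring
  by_cases hi : k = i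
  · subst hi; simp only [Pi.add_apply, exchange_apply_left hj]; ring
  · simp only [Pi.add_apply, exchange_apply_of_ne hi hj]

theorem exchange_smul {N : ℕ} {i j : Fin N} (hij : i ≠ j) (a c : ℝ) (η : Fin N → ℝ) :
    exchange i j a (c • η) = c • exchange i j a η := by
  ext k
  by_cases hj : k = j
  · subst hj; simp only [Pi.smul_apply, exchange_apply_right, smul_eq_mul]; ring
  by_cases hi : k = i
  · subst hi; simp only [Pi.smul_apply, exchange_apply_left hj, smul_eq_mul]; ring
  · simp only [Pi.smul_apply, exchange_apply_of_ne hi hj]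

/-- Change of a sum over the sites in a collision. -/
theorem sum_exchange {N : ℕ} {i j : Fin N} (hij : i ≠ j) (a : ℝ) (η : Fin N → ℝ)
    (φ : Fin N → ℝ → ℝ) :
    ∑ k, φ k (exchange i j a η k) = ∑ k, φ k (η k) - φ i (η i) - φ j (η j) +
      φ i (a * (η i + η j)) + φ j ((1 - a) * (η i + η j)) := by
  have hji : j ∈ Finset.univ.erase i := Finset.mem_erase.2 ⟨hij.symm, Finset.mem_univ j⟩
  rw [← Finset.add_sum_erase _ _ (Finset.mem_univ i), ← Finset.add_sum_erase _ _ hji,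
    ← Finset.add_sum_erase Finset.univ (fun k => φ k (η k)) (Finset.mem_univ i),
    ← Finset.add_sum_erase _ (fun k => φ k (η k)) hji,
    exchange_apply_left hij, exchange_apply_right]
  have : ∑ k ∈ (Finset.univ.erase i).erase j, φ k (exchange i j a η k)
      = ∑ k ∈ (Finset.univ.erase i).erase j, φ k (η k) := by
    refine Finset.sum_congr rfl fun k hk => ?_
    rw [Finset.mem_erase, Finset.mem_erase] at hk
    rw [exchange_apply_of_ne hk.2.1 hk.1]
  rw [this]; ring

theorem sum_exchange_self {N : ℕ} {i j : Fin N} (hij : i ≠ j) (a : ℝ) (η : Fin N → ℝ) :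
    ∑ k, exchange i j a η k = ∑ k, η k := by
  rw [sum_exchange hij a η fun _ x => x]; ring

theorem measurable_exchange {N : ℕ} (i j : Fin N) :
    Measurable fun p : (Fin N → ℝ) × ℝ => exchange i j p.2 p.1 := by
  refine measurable_pi_iff.2 fun k => ?_
  by_cases hj : k = j
  · subst hj; simp only [exchange_apply_right]; fun_prop
  by_cases hi : k = i
  · subst hi; simp only [exchange_apply_left hj]; fun_prop
  · simp only [exchange_apply_of_ne hi hj]; fun_prop

theorem lintegral_productLaw_exchange {γ : ℝ} (hγ : 0 < γ) {N : ℕ} {i j : Fin N} (hij : i ≠ j)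
    (F : (Fin N → ℝ) → ℝ≥0∞) (hF : Measurable F) :
    ∫⁻ η, ∫⁻ a, F (exchange i j a η) ∂(betaMeasure γ γ) ∂(productLaw γ N) =
      ∫⁻ η, F η ∂(productLaw γ N) := by
  have hβ := isProbabilityMeasureBeta hγ hγ
  have hG := isProbabilityMeasure_gammaMeasure hγ one_pos
  have hF' : Measurable fun p : (Fin N → ℝ) × ℝ => F (exchange i j p.2 p.1) :=
    hF.comp (measurable_exchange i j)
  have hm : Measurable fun η => ∫⁻ a, F (exchange i j a η) ∂(betaMeasure γ γ) :=
    hF'.lintegral_prod_right'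
  refine lintegral_eq_of_lmarginal_eq {i, j} hm hF ?_
  ext η
  rw [lmarginal_insert _ hm (by simpa using hij), lmarginal_insert _ hF (by simpa using hij)]
  simp only [lmarginal_singleton]
  have hpair := lintegral_gamma_pair_exchange hγ
    (fun q => F (Function.update (Function.update η i q.1) j q.2)) (by
      refine hF.comp (measurable_pi_iff.2 fun k => ?_)
      by_cases hj : k = j
      · subst hj; simp only [Function.update_self]; fun_prop
      by_cases hi : k = i
      · subst hi; simp only [Function.update_of_ne hj, Function.update_self]; fun_prop
      · simp only [Function.update_of_ne hj, Function.update_of_ne hi]; fun_prop)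
  rw [← hpair]
  refine lintegral_congr fun x => lintegral_congr fun y => lintegral_congr fun a => ?_
  congr 1
  ext k
  by_cases hj : k = j
  · subst hj; simp [exchange, hij]
  by_cases hi : k = i
  · subst hi; simp [exchange, hj]
  · simp [exchange, hi, hj]

/-- A Beta collision between two sites leaves the conditional law invariant. -/
theorem measurePreserving_exchange {γ : ℝ} (hγ : 0 < γ) {N : ℕ} {i j : Fin N} (hij : i ≠ j)
    (ω : ℝ) :
    MeasurePreserving (fun p : (Fin N → ℝ) × ℝ => exchange i j p.2 p.1)
      ((condLaw γ N ω).prod (betaMeasure γ γ)) (condLaw γ N ω) := by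
  have hβ := isProbabilityMeasureBeta hγ hγ
  have hν := isProbabilityMeasure_condLaw hγ N ω
  refine ⟨measurable_exchange i j, Measure.ext_of_lintegral _ fun F hF => ?_⟩
  have hF' : Measurable fun p : (Fin N → ℝ) × ℝ => F (exchange i j p.2 p.1) :=
    hF.comp (measurable_exchange i j)
  rw [lintegral_map hF (measurable_exchange i j), lintegral_prod _ hF'.aemeasurable, condLaw,
    lintegral_map hF'.lintegral_prod_right' (measurable_rescale N ω),
    lintegral_map hF (measurable_rescale N ω)]
  refine Eq.trans ?_
    (lintegral_productLaw_exchange hγ hij _ (hF.comp (measurable_rescale N ω)))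
  refine lintegral_congr fun η => lintegral_congr fun a => ?_
  simp only [exchange_smul hij, sum_exchange_self hij]

/-! ### Conditional expectations as collision averages -/

/-- The average of `f` over a collision of the sites `i, j` with a Beta(`γ`, `γ`) fraction. -/
noncomputable def collide {N : ℕ} (γ : ℝ) (i j : Fin N) (f : (Fin N → ℝ) → ℝ) (η : Fin N → ℝ) :
    ℝ :=
  ∫ a, f (exchange i j a η) ∂(betaMeasure γ γ)

theorem pairComplement_le {N : ℕ} (i j : Fin N) :
    pairComplement i j ≤ (inferInstance : MeasurableSpace (Fin N → ℝ)) := by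
  refine Measurable.comap_le (f := fun (η : Fin N → ℝ) (k : {k : Fin N // k ≠ i ∧ k ≠ j}) => η k) ?_
  fun_prop

theorem measurable_collide {γ : ℝ} (hγ : 0 < γ) {N : ℕ} (i j : Fin N) {f : (Fin N → ℝ) → ℝ}
    (hf : Measurable f) : Measurable (collide γ i j f) := by
  have hβ := isProbabilityMeasureBeta hγ hγ
  exact (StronglyMeasurable.integral_prod_right' (f := fun p : (Fin N → ℝ) × ℝ =>
    f (exchange i j p.2 p.1)) (hf.comp (measurable_exchange i j)).stronglyMeasurable).measurable

/-- The configuration with the given energies outside the pair `i, j`, whose site `i` carries the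
energy left over from the total `ω`, and whose site `j` carries none. -/
noncomputable def fillPair {N : ℕ} (i j : Fin N) (ω : ℝ) (y : {k : Fin N // k ≠ i ∧ k ≠ j} → ℝ) :
    Fin N → ℝ := fun k =>
  if h : k ≠ i ∧ k ≠ j then y ⟨k, h⟩ else if k = i then ω - ∑ l, y l else 0

theorem measurable_fillPair {N : ℕ} (i j : Fin N) (ω : ℝ) : Measurable (fillPair i j ω) := by
  refine measurable_pi_iff.2 fun k => ?_
  unfold fillPair
  by_cases h : k ≠ i ∧ k ≠ j
  · simp only [dif_pos h]; fun_prop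
  · simp only [dif_neg h]
    by_cases hi : k = i
    · simp only [hi, if_true]; fun_prop
    · simp only [hi, if_false]; fun_prop

theorem exchange_fillPair {N : ℕ} {i j : Fin N} (hij : i ≠ j) {ω : ℝ} {η : Fin N → ℝ}
    (hη : ∑ k, η k = ω) (a : ℝ) :
    exchange i j a (fillPair i j ω fun k => η k) = exchange i j a η := by
  refine exchange_congr (fun k hi hj => ?_) ?_ a
  · simp [fillPair, hi, hj]
  · have h1 : fillPair i j ω (fun k => η k) j = 0 := by simp [fillPair, hij.symm]
    have h2 : fillPair i j ω (fun k => η k) i = ω - ∑ l : {k : Fin N // k ≠ i ∧ k ≠ j}, η l := by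
      simp [fillPair]
    have h3 : ∑ l : {k : Fin N // k ≠ i ∧ k ≠ j}, η l = ∑ k ∈ (Finset.univ.erase i).erase j, η k := by
      refine (Finset.sum_subtype _ (fun k => ?_) η).symm
      simp [and_comm]
    have hji : j ∈ Finset.univ.erase i := Finset.mem_erase.2 ⟨hij.symm, Finset.mem_univ j⟩
    rw [h1, h2, h3, ← hη, ← Finset.add_sum_erase _ _ (Finset.mem_univ i),
      ← Finset.add_sum_erase _ _ hji]
    ring

theorem ae_integrable_exchange {γ : ℝ} (hγ : 0 < γ) {N : ℕ} {i j : Fin N} (hij : i ≠ j) {ω : ℝ}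
    {f : (Fin N → ℝ) → ℝ} (hf : Integrable f (condLaw γ N ω)) :
    ∀ᵐ η ∂(condLaw γ N ω), Integrable (fun a => f (exchange i j a η)) (betaMeasure γ γ) := by
  have hβ := isProbabilityMeasureBeta hγ hγ
  have hν := isProbabilityMeasure_condLaw hγ N ω
  exact ((measurePreserving_exchange hγ hij ω).integrable_comp_of_integrable hf).prod_right_ae

/-- Collisions depend only on the almost everywhere class of the observable. -/
theorem collide_congr_ae {γ : ℝ} (hγ : 0 < γ) {N : ℕ} {i j : Fin N} (hij : i ≠ j) {ω : ℝ}
    {f g : (Fin N → ℝ) → ℝ} (h : f =ᵐ[condLaw γ N ω] g) :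
    collide γ i j f =ᵐ[condLaw γ N ω] collide γ i j g := by
  have hβ := isProbabilityMeasureBeta hγ hγ
  have hν := isProbabilityMeasure_condLaw hγ N ω
  have := (measurePreserving_exchange hγ hij ω).quasiMeasurePreserving.ae h
  filter_upwards [Measure.ae_ae_of_ae_prod this] with η hη
  exact integral_congr_ae hη

/-- Conditioning on the energies outside a pair amounts to a collision of that pair. The pair energy
`ω - ∑ η k` is a function of the other energies, and the collision resamples the pair given it. -/
theorem collide_ae_eq_condExp {γ : ℝ} (hγ : 0 < γ) {N : ℕ} {i j : Fin N} (hij : i ≠ j) {ω : ℝ}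
    (hω : 0 ≤ ω) {f : (Fin N → ℝ) → ℝ} (hf : Integrable f (condLaw γ N ω)) :
    collide γ i j f =ᵐ[condLaw γ N ω] (condLaw γ N ω)[f | pairComplement i j] := by
  have hβ := isProbabilityMeasureBeta hγ hγ
  have hν := isProbabilityMeasure_condLaw hγ N ω
  have hN : 1 ≤ N := (Nat.zero_le _).trans_lt i.isLt
  have hmp := measurePreserving_exchange hγ hij ω
  have hfi := hmp.integrable_comp_of_integrable hf
  refine ae_eq_condExp_of_forall_setIntegral_eq (pairComplement_le i j) hf
    (fun s _ _ => hfi.integral_prod_left.integrableOn) ?_ ?_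
  · rintro s ⟨s', hs', rfl⟩ -
    set r : (Fin N → ℝ) → {k : Fin N // k ≠ i ∧ k ≠ j} → ℝ := fun η k => η k with hr
    have hrm : Measurable r := by fun_prop
    have hre : ∀ a η, r (exchange i j a η) = r η := fun a η => by
      ext k; exact exchange_apply_of_ne k.2.1 k.2.2 a η
    have hs := hrm hs'
    have hpre : (fun p : (Fin N → ℝ) × ℝ => exchange i j p.2 p.1) ⁻¹' (r ⁻¹' s')
        = (r ⁻¹' s') ×ˢ Set.univ := by
      ext p; simp [hre]
    have h1 : ∫ η in r ⁻¹' s', f η ∂(condLaw γ N ω) =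
        ∫ p in (r ⁻¹' s') ×ˢ Set.univ, f (exchange i j p.2 p.1)
          ∂((condLaw γ N ω).prod (betaMeasure γ γ)) := by
      rw [← hpre]
      conv_lhs => rw [← hmp.map_eq]
      refine setIntegral_map hs ?_ (measurable_exchange i j).aemeasurable
      rw [hmp.map_eq]; exact hf.aestronglyMeasurable
    have h2 := setIntegral_prod _ (hfi.integrableOn (s := (r ⁻¹' s') ×ˢ Set.univ))
    simp only [Measure.restrict_univ, Function.comp_apply] at h2
    rw [h1, h2]
    rfl
  · obtain ⟨g, hg, hfg⟩ := hf.aestronglyMeasurable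
    refine AEStronglyMeasurable.congr (f := fun η => collide γ i j g (fillPair i j ω fun k => η k))
      ?_ ?_
    · refine (Measurable.stronglyMeasurable ?_).aestronglyMeasurable
      exact ((measurable_collide hγ i j hg.measurable).comp (measurable_fillPair i j ω)).comp
        (comap_measurable _)
    · refine Filter.EventuallyEq.trans ?_ (collide_congr_ae hγ hij hfg).symm
      filter_upwards [condLaw_sum_eq hγ hN hω] with η hη
      simp only [collide, exchange_fillPair hij hη.2]

theorem exchangeGenerator_ae_eq_averageGenerator {γ : ℝ} (hγ : 0 < γ) {N : ℕ} {ω : ℝ}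
    (hω : 0 ≤ ω) {f : (Fin N → ℝ) → ℝ} (hf : Integrable f (condLaw γ N ω)) :
    exchangeGenerator γ f =ᵐ[condLaw γ N ω] averageGenerator (condLaw γ N ω) f := by
  have hβ := isProbabilityMeasureBeta hγ hγ
  have hall : ∀ᵐ η ∂(condLaw γ N ω), ∀ p : Fin N × Fin N, p.1 < p.2 →
      ∫ a, (f (exchange p.1 p.2 a η) - f η) ∂(betaMeasure γ γ) =
        ((condLaw γ N ω)[f | pairComplement p.1 p.2]) η - f η := by
    refine ae_all_iff.2 fun p => ?_
    by_cases hp : p.1 < p.2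
    · filter_upwards [ae_integrable_exchange hγ hp.ne hf,
        collide_ae_eq_condExp hγ hp.ne hω hf] with η h1 h2 _
      rw [integral_sub h1 (integrable_const _), ← h2]
      simp [collide]
    · exact Filter.Eventually.of_forall fun η h => absurd h hp
  filter_upwards [hall] with η hη
  unfold exchangeGenerator averageGenerator
  congr 1
  exact Finset.sum_congr rfl fun p hp => hη p (Finset.mem_filter.1 hp).2

/-! ### Moments of the Beta law -/

theorem integral_pow_betaMeasure {γ : ℝ} (hγ : 0 < γ) (n : ℕ) :
    ∫ a, a ^ n ∂(betaMeasure γ γ) = beta (γ + n) γ / beta γ γ := by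
  have hB := beta_pos hγ hγ
  have hγn : 0 < γ + n := by positivity
  have hBn := beta_pos hγn hγ
  have hnn : ∀ x, 0 ≤ betaPDFReal (γ + n) γ x := fun x => by
    by_cases h : 0 < x ∧ x < 1
    · exact (betaPDFReal_pos h.1 h.2 hγn hγ).le
    · rw [betaPDFReal, if_neg h]
  have hone : ∫ x, betaPDFReal (γ + n) γ x = 1 := by
    rw [integral_eq_lintegral_of_nonneg_ae (Filter.Eventually.of_forall hnn)
      (stronglyMeasurable_betaPDFReal _ _).aestronglyMeasurable]
    have := lintegral_betaPDF_eq_one hγn hγ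
    unfold betaPDF at this
    rw [this, ENNReal.toReal_one]
  rw [betaMeasure, integral_withDensity_eq_integral_toReal_smul (measurable_betaPDF γ γ)
    (Filter.Eventually.of_forall fun x => ENNReal.ofReal_lt_top)]
  have : ∀ x : ℝ, (betaPDF γ γ x).toReal • x ^ n =
      beta (γ + n) γ / beta γ γ * betaPDFReal (γ + n) γ x := by
    intro x
    unfold betaPDF betaPDFReal
    by_cases h : 0 < x ∧ x < 1
    · have h1 : 0 < 1 - x := by linarith [h.2]
      have h0 := h.1
      rw [if_pos h, if_pos h, ENNReal.toReal_ofReal (by positivity), smul_eq_mul,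
        show γ + n - 1 = (γ - 1) + n by ring, Real.rpow_add h0, Real.rpow_natCast]
      field_simp
    · simp [h]
  simp only [this]
  rw [integral_const_mul, hone, mul_one]

theorem integral_id_betaMeasure {γ : ℝ} (hγ : 0 < γ) : ∫ a, a ∂(betaMeasure γ γ) = 1 / 2 := by
  have h := integral_pow_betaMeasure hγ 1
  simp only [pow_one, Nat.cast_one] at h
  have hG := Real.Gamma_pos_of_pos hγ
  have hG2 := Real.Gamma_pos_of_pos (show 0 < γ + γ by linarith)
  rw [h, beta, beta, Real.Gamma_add_one hγ.ne', show γ + 1 + γ = (γ + γ) + 1 by ring,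
    Real.Gamma_add_one (by linarith)]
  field_simp
  ring

theorem integral_sq_betaMeasure {γ : ℝ} (hγ : 0 < γ) :
    ∫ a, a ^ 2 ∂(betaMeasure γ γ) = (γ + 1) / (2 * (2 * γ + 1)) := by
  have h := integral_pow_betaMeasure hγ 2
  have hG := Real.Gamma_pos_of_pos hγ
  have hG2 := Real.Gamma_pos_of_pos (show 0 < γ + γ by linarith)
  rw [h, beta, beta, Nat.cast_ofNat, show γ + 2 = γ + 1 + 1 by ring,
    Real.Gamma_add_one (by linarith), Real.Gamma_add_one hγ.ne',
    show γ + 1 + 1 + γ = (γ + γ) + 1 + 1 by ring,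
    Real.Gamma_add_one (by linarith), Real.Gamma_add_one (by linarith)]
  field_simp
  ring

theorem betaMeasure_mem_Ioo (a b : ℝ) : ∀ᵐ x ∂(betaMeasure a b), x ∈ Set.Ioo (0 : ℝ) 1 := by
  rw [betaMeasure, ae_withDensity_iff (measurable_betaPDF a b)]
  filter_upwards with x hx
  by_contra h
  rw [Set.mem_Ioo, not_and_or, not_lt, not_lt] at h
  exact hx (h.elim betaPDF_eq_zero_of_nonpos betaPDF_eq_zero_of_one_le)

theorem integrable_betaMeasure {γ : ℝ} (hγ : 0 < γ) {f : ℝ → ℝ} (hf : Measurable f) {C : ℝ}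
    (hC : ∀ a ∈ Set.Ioo (0 : ℝ) 1, |f a| ≤ C) : Integrable f (betaMeasure γ γ) := by
  have hβ := isProbabilityMeasureBeta hγ hγ
  refine Integrable.of_bound hf.aestronglyMeasurable C ?_
  filter_upwards [betaMeasure_mem_Ioo γ γ] with a ha using hC a ha

/-- The average over a Beta fraction of the sum of the squares of the two fractions. -/
theorem integral_sq_add_sq_betaMeasure {γ : ℝ} (hγ : 0 < γ) :
    ∫ a, (a ^ 2 + (1 - a) ^ 2) ∂(betaMeasure γ γ) = (γ + 1) / (2 * γ + 1) := by
  have hβ := isProbabilityMeasureBeta hγ hγ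
  have i1 : Integrable (fun a : ℝ => a) (betaMeasure γ γ) :=
    integrable_betaMeasure hγ (by fun_prop) (C := 1) fun a ha => by
      rw [abs_of_pos ha.1]; exact ha.2.le
  have i2 : Integrable (fun a : ℝ => a ^ 2) (betaMeasure γ γ) :=
    integrable_betaMeasure hγ (by fun_prop) (C := 1) fun a ha => by
      rw [abs_of_nonneg (sq_nonneg a)]; nlinarith [ha.1, ha.2]
  have : ∀ a : ℝ, a ^ 2 + (1 - a) ^ 2 = 2 * a ^ 2 - 2 * a + 1 := fun a => by ring
  simp only [this]
  have i3 : Integrable (fun a : ℝ => 2 * a ^ 2 - 2 * a) (betaMeasure γ γ) :=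
    (i2.const_mul 2).sub (i1.const_mul 2)
  rw [integral_add i3 (integrable_const _), integral_sub (i2.const_mul 2) (i1.const_mul 2), integral_const_mul, integral_const_mul,
    integral_id_betaMeasure hγ, integral_sq_betaMeasure hγ]
  simp
  field_simp

/-! ### Sums over pairs -/

theorem sum_pairs_eq {N : ℕ} (φ : Fin N → Fin N → ℝ) (hφ : ∀ i j, φ i j = φ j i) :
    ∑ p : Fin N × Fin N with p.1 < p.2, φ p.1 p.2 = (∑ i, ∑ j, φ i j - ∑ i, φ i i) / 2 := by
  have h1 : ∀ i j, φ i j = (if i < j then φ i j else 0) + (if j < i then φ j i else 0) +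
      (if i = j then φ i i else 0) := by
    intro i j
    rcases lt_trichotomy i j with h | h | h
    · simp [h, h.not_gt, h.ne]
    · simp [h]
    · simp [h, h.not_gt, h.ne', hφ i j]
  have h2 : ∑ i, ∑ j, φ i j = ∑ i, ∑ j, (if i < j then φ i j else 0) +
      ∑ i, ∑ j, (if j < i then φ j i else 0) + ∑ i, ∑ j, (if i = j then φ i i else 0) := by
    simp only [← Finset.sum_add_distrib]
    exact Finset.sum_congr rfl fun i _ => Finset.sum_congr rfl fun j _ => h1 i j
  rw [Finset.sum_comm (f := fun i j => if j < i then φ j i else 0)] at h2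
  simp only [Finset.sum_ite_eq, Finset.mem_univ, if_true] at h2
  rw [Finset.sum_filter, Fintype.sum_prod_type, h2]
  ring

/-- The number of pairs of sites. -/
noncomputable def pairCount (N : ℕ) : ℝ := N * (N - 1) / 2

theorem sum_pairs_const (N : ℕ) (x : ℝ) :
    ∑ p : Fin N × Fin N with p.1 < p.2, x = pairCount N * x := by
  rw [sum_pairs_eq (fun _ _ => x) fun _ _ => rfl]
  simp [pairCount]; ring

/-- The eigenvalue of `∑_{i<j} (1 - ν[· | η k, k ≠ i, j])` at the centred sum
of squares `∑ k, η k ^ 2`; `N` times the spectral gap. -/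
noncomputable def pairGap (γ : ℝ) (N : ℕ) : ℝ := (γ * N + 1) / (2 * γ + 1)

theorem sum_pairs_sq {γ : ℝ} (hγ : 0 < γ) {N : ℕ} (z : Fin N → ℝ) :
    ∑ p : Fin N × Fin N with p.1 < p.2, (∑ k, z k ^ 2 - z p.1 ^ 2 - z p.2 ^ 2 +
      (γ + 1) / (2 * γ + 1) * (z p.1 + z p.2) ^ 2) =
      (pairCount N - pairGap γ N) * ∑ k, z k ^ 2 +
        (γ + 1) / (2 * γ + 1) * (∑ k, z k) ^ 2 := by
  rw [sum_pairs_eq (fun i j => ∑ k, z k ^ 2 - z i ^ 2 - z j ^ 2 +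
      (γ + 1) / (2 * γ + 1) * (z i + z j) ^ 2) fun i j => by ring]
  set q := ∑ k, z k ^ 2 with hq
  set m := (γ + 1) / (2 * γ + 1) with hm
  have e1 : ∑ i, ∑ j, (q - z i ^ 2 - z j ^ 2 + m * (z i + z j) ^ 2) =
      N * N * q - 2 * N * q + m * (2 * N * q + 2 * (∑ k, z k) ^ 2) := by
    have : ∀ i j, q - z i ^ 2 - z j ^ 2 + m * (z i + z j) ^ 2 =
        q + (m - 1) * z i ^ 2 + (m - 1) * z j ^ 2 + 2 * m * (z i * z j) := fun i j => by ring
    simp only [this, Finset.sum_add_distrib, ← Finset.mul_sum, ← Finset.sum_mul, ← hq]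
    simp
    rw [← Finset.mul_sum, ← hq]
    ring
  have e2 : ∑ i, (q - z i ^ 2 - z i ^ 2 + m * (z i + z i) ^ 2) = N * q - 2 * q + 4 * m * q := by
    have : ∀ i, q - z i ^ 2 - z i ^ 2 + m * (z i + z i) ^ 2 = q + (4 * m - 2) * z i ^ 2 :=
      fun i => by ring
    simp only [this, Finset.sum_add_distrib, ← Finset.mul_sum, ← hq]
    simp
    ring
  rw [e1, e2, pairCount, pairGap, hm]
  field_simp
  ring

theorem sum_pairs_linear {N : ℕ} (b z : Fin N → ℝ) :
    ∑ p : Fin N × Fin N with p.1 < p.2,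
      (∑ k, b k * z k - (b p.1 - b p.2) * (z p.1 - z p.2) / 2) =
      (pairCount N - N / 2) * ∑ k, b k * z k + (∑ k, b k) * (∑ k, z k) / 2 := by
  rw [sum_pairs_eq (fun i j => ∑ k, b k * z k - (b i - b j) * (z i - z j) / 2) fun i j => by ring]
  set q := ∑ k, b k * z k with hq
  have e1 : ∑ i, ∑ j, (q - (b i - b j) * (z i - z j) / 2) =
      N * N * q - N * q + (∑ k, b k) * ∑ k, z k := by
    have : ∀ i j, q - (b i - b j) * (z i - z j) / 2 =
        q + (- (1 / 2)) * (b i * z i) + (- (1 / 2)) * (b j * z j) + (1 / 2) * (b i * z j)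
          + (1 / 2) * (z i * b j) := fun i j => by ring
    simp only [this, Finset.sum_add_distrib, ← Finset.mul_sum, ← Finset.sum_mul, ← hq]
    simp
    have : ∑ x, b x * ((N : ℝ) * z x) = N * q := by
      rw [hq, Finset.mul_sum]; exact Finset.sum_congr rfl fun _ _ => by ring
    rw [this]
    ring
  rw [e1]
  simp [pairCount]
  ring

/-! ### Functions with bounded second differences on the simplex -/

/-- The configurations with nonnegative energies and total energy `ω`. -/
def energySimplex (N : ℕ) (ω : ℝ) : Set (Fin N → ℝ) := {x | (∀ i, 0 ≤ x i) ∧ ∑ i, x i = ω}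

theorem energySimplex_convex (N : ℕ) (ω : ℝ) : Convex ℝ (energySimplex N ω) := by
  rintro x ⟨hx, hx'⟩ y ⟨hy, hy'⟩ u v hu hv huv
  refine ⟨fun i => add_nonneg (mul_nonneg hu (hx i)) (mul_nonneg hv (hy i)), ?_⟩
  simp only [Pi.add_apply, Pi.smul_apply, smul_eq_mul, Finset.sum_add_distrib, ← Finset.mul_sum,
    hx', hy', ← add_mul, huv, one_mul]

theorem exchange_mem_energySimplex {N : ℕ} {ω : ℝ} {i j : Fin N} (hij : i ≠ j) {a : ℝ}
    (ha : a ∈ Set.Ioo (0 : ℝ) 1) {x : Fin N → ℝ} (hx : x ∈ energySimplex N ω) :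
    exchange i j a x ∈ energySimplex N ω := by
  have h1 : 0 ≤ 1 - a := by linarith [ha.2]
  have hs := add_nonneg (hx.1 i) (hx.1 j)
  refine ⟨fun k => ?_, by rw [sum_exchange_self hij, hx.2]⟩
  by_cases hj : k = j
  · subst hj; rw [exchange_apply_right]; positivity
  by_cases hi : k = i
  · subst hi; rw [exchange_apply_left hj]; exact mul_nonneg ha.1.le hs
  · rw [exchange_apply_of_ne hi hj]; exact hx.1 k

/-- The function `f` is measurable, and on the simplex of total energy `ω` its deviation from
linearity along segments is at most `t` times that of the square norm. Equivalently
`t * ∑ k, x k ^ 2 + f` and `t * ∑ k, x k ^ 2 - f` are convex there: this is the bound `2 t` on the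
tangential Hessian of `f`, in a form that needs no derivatives. -/
structure HessianBound (N : ℕ) (ω t : ℝ) (f : (Fin N → ℝ) → ℝ) : Prop where
  nonneg : 0 ≤ t
  measurable : Measurable f
  bound : ∀ x ∈ energySimplex N ω, ∀ y ∈ energySimplex N ω, ∀ u v : ℝ, 0 ≤ u → 0 ≤ v →
    u + v = 1 → |u * f x + v * f y - f (u • x + v • y)| ≤ t * (u * v * ∑ k, (x k - y k) ^ 2)

theorem sum_sq_segment {N : ℕ} (x y : Fin N → ℝ) {u v : ℝ} (h : u + v = 1) :
    u * ∑ k, x k ^ 2 + v * ∑ k, y k ^ 2 - ∑ k, (u • x + v • y) k ^ 2 =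
      u * v * ∑ k, (x k - y k) ^ 2 := by
  simp only [Finset.mul_sum, ← Finset.sum_add_distrib, ← Finset.sum_sub_distrib]
  refine Finset.sum_congr rfl fun k _ => ?_
  obtain rfl : v = 1 - u := by linarith
  simp only [Pi.add_apply, Pi.smul_apply, smul_eq_mul]
  ring

namespace HessianBound

variable {N : ℕ} {ω t s : ℝ} {f g : (Fin N → ℝ) → ℝ}

theorem linear (N : ℕ) (ω : ℝ) (b : Fin N → ℝ) :
    HessianBound N ω 0 fun x => ∑ k, b k * x k := by
  refine ⟨le_rfl, by fun_prop, fun x _ y _ u v _ _ _ => ?_⟩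
  have : u * ∑ k, b k * x k + v * ∑ k, b k * y k - ∑ k, b k * (u • x + v • y) k = 0 := by
    simp only [Finset.mul_sum, ← Finset.sum_add_distrib, ← Finset.sum_sub_distrib]
    refine Finset.sum_eq_zero fun k _ => ?_
    simp only [Pi.add_apply, Pi.smul_apply, smul_eq_mul]
    ring
  rw [this]; simp

theorem add (hf : HessianBound N ω t f) (hg : HessianBound N ω s g) :
    HessianBound N ω (t + s) (f + g) := by
  refine ⟨add_nonneg hf.nonneg hg.nonneg, hf.measurable.add hg.measurable,
    fun x hx y hy u v hu hv huv => ?_⟩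
  have h1 := hf.bound x hx y hy u v hu hv huv
  have h2 := hg.bound x hx y hy u v hu hv huv
  rw [add_mul]
  refine le_trans (le_of_eq ?_) ((abs_add_le _ _).trans (add_le_add h1 h2))
  simp only [Pi.add_apply]
  congr 1; ring

theorem smul (hf : HessianBound N ω t f) (c : ℝ) : HessianBound N ω (|c| * t) (c • f) := by
  refine ⟨mul_nonneg (abs_nonneg c) hf.nonneg, hf.measurable.const_smul c,
    fun x hx y hy u v hu hv huv => ?_⟩
  have h1 := hf.bound x hx y hy u v hu hv huv
  rw [mul_assoc]
  refine le_trans (le_of_eq ?_) (mul_le_mul_of_nonneg_left h1 (abs_nonneg c))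
  rw [← abs_mul]
  simp only [Pi.smul_apply, smul_eq_mul]
  congr 1; ring

theorem convexOn (hf : HessianBound N ω t f) :
    ConvexOn ℝ (energySimplex N ω) fun x => t * ∑ k, x k ^ 2 + f x := by
  refine ⟨energySimplex_convex N ω, fun x hx y hy u v hu hv huv => ?_⟩
  have h1 := (abs_le.1 (hf.bound x hx y hy u v hu hv huv)).1
  rw [← sum_sq_segment x y huv] at h1
  simp only [smul_eq_mul]
  linarith

/-- A function with a Hessian bound is close to its affine interpolation at the vertices: Jensen's
inequality for the two convex functions `t * ∑ k, x k ^ 2 ± f`. -/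
theorem abs_sub_interpolation_le (hω : 0 < ω) (hf : HessianBound N ω t f) {x : Fin N → ℝ}
    (hx : x ∈ energySimplex N ω) :
    |f x - ∑ k, f (Pi.single k ω) / ω * x k| ≤ t * ω ^ 2 := by
  have key : ∀ g : (Fin N → ℝ) → ℝ, HessianBound N ω t g →
      g x - ∑ k, g (Pi.single k ω) / ω * x k ≤ t * ω ^ 2 := by
    intro g hg
    have hJ := hg.convexOn.map_sum_le (t := Finset.univ) (w := fun k => x k / ω)
      (p := fun k => Pi.single k ω) (fun k _ => div_nonneg (hx.1 k) hω.le)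
      (by rw [← Finset.sum_div, hx.2, div_self hω.ne'])
      (fun k _ => ⟨fun i => by
        by_cases h : i = k
        · subst h; simp [hω.le]
        · simp [h], by simp⟩)
    have hp : ∑ k, (x k / ω) • (Pi.single k ω : Fin N → ℝ) = x := by
      ext l
      simp only [Finset.sum_apply, Pi.smul_apply, smul_eq_mul, Pi.single_apply, mul_ite, mul_zero,
        Finset.sum_ite_eq, Finset.mem_univ, if_true]
      field_simp
    rw [hp] at hJ
    have hsq : ∀ k : Fin N, ∑ l, (Pi.single k ω : Fin N → ℝ) l ^ 2 = ω ^ 2 := by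
      intro k
      simp [Pi.single_apply, ite_pow]
    simp only [hsq, smul_eq_mul, mul_add, Finset.sum_add_distrib] at hJ
    rw [← Finset.sum_mul, ← Finset.sum_div, hx.2, div_self hω.ne', one_mul] at hJ
    have h0 : 0 ≤ t * ∑ k, x k ^ 2 :=
      mul_nonneg hg.nonneg (Finset.sum_nonneg fun k _ => sq_nonneg _)
    have : ∑ k, g (Pi.single k ω) / ω * x k = ∑ k, x k / ω * g (Pi.single k ω) :=
      Finset.sum_congr rfl fun k _ => by ring
    rw [this]
    linarith
  refine abs_le.2 ⟨?_, key f hf⟩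
  have hneg : HessianBound N ω t ((-1 : ℝ) • f) := by simpa using hf.smul (-1)
  have := key _ hneg
  simp only [Pi.smul_apply, smul_eq_mul, neg_mul, one_mul, neg_div, Finset.sum_neg_distrib] at this
  linarith

theorem exists_bound (hω : 0 < ω) (hf : HessianBound N ω t f) :
    ∃ C, ∀ x ∈ energySimplex N ω, |f x| ≤ C := by
  refine ⟨t * ω ^ 2 + ∑ k, |f (Pi.single k ω) / ω| * ω, fun x hx => ?_⟩
  have h1 := hf.abs_sub_interpolation_le hω hx
  have h2 : |∑ k, f (Pi.single k ω) / ω * x k| ≤ ∑ k, |f (Pi.single k ω) / ω| * ω := by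
    refine (Finset.abs_sum_le_sum_abs _ _).trans (Finset.sum_le_sum fun k _ => ?_)
    rw [abs_mul, abs_of_nonneg (hx.1 k)]
    refine mul_le_mul_of_nonneg_left ?_ (abs_nonneg _)
    rw [← hx.2]
    exact Finset.single_le_sum (f := x) (fun l _ => hx.1 l) (Finset.mem_univ k)
  have h3 := abs_sub_abs_le_abs_sub (f x) (∑ k, f (Pi.single k ω) / ω * x k)
  linarith

end HessianBound

/-- The sum over all pairs of the collision averages. -/
noncomputable def collideSum {N : ℕ} (γ : ℝ) (f : (Fin N → ℝ) → ℝ) (x : Fin N → ℝ) : ℝ :=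
  ∑ p : Fin N × Fin N with p.1 < p.2, collide γ p.1 p.2 f x

theorem HessianBound.integrable_exchange {N : ℕ} {ω t γ : ℝ} {f : (Fin N → ℝ) → ℝ} (hγ : 0 < γ)
    (hω : 0 < ω) (hf : HessianBound N ω t f) {i j : Fin N} (hij : i ≠ j) {x : Fin N → ℝ}
    (hx : x ∈ energySimplex N ω) :
    Integrable (fun a => f (exchange i j a x)) (betaMeasure γ γ) := by
  obtain ⟨C, hC⟩ := hf.exists_bound hω
  exact integrable_betaMeasure hγ
    ((hf.measurable.comp (measurable_exchange i j)).comp measurable_prodMk_left)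
    fun a ha => hC _ (exchange_mem_energySimplex hij ha hx)

theorem sum_sq_exchange {N : ℕ} {i j : Fin N} (hij : i ≠ j) (a : ℝ) (z : Fin N → ℝ) :
    ∑ k, exchange i j a z k ^ 2 = ∑ k, z k ^ 2 - z i ^ 2 - z j ^ 2 +
      (a ^ 2 + (1 - a) ^ 2) * (z i + z j) ^ 2 := by
  rw [sum_exchange hij a z fun _ x => x ^ 2]; ring

theorem collide_sum_sq {γ : ℝ} (hγ : 0 < γ) {N : ℕ} {i j : Fin N} (hij : i ≠ j)
    (z : Fin N → ℝ) :
    Integrable (fun a => ∑ k, exchange i j a z k ^ 2) (betaMeasure γ γ) ∧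
    collide γ i j (fun x => ∑ k, x k ^ 2) z = ∑ k, z k ^ 2 - z i ^ 2 - z j ^ 2 +
      (γ + 1) / (2 * γ + 1) * (z i + z j) ^ 2 := by
  have hβ := isProbabilityMeasureBeta hγ hγ
  have i2 : Integrable (fun a : ℝ => a ^ 2 + (1 - a) ^ 2) (betaMeasure γ γ) :=
    integrable_betaMeasure hγ (by fun_prop) (C := 1) fun a ha => by
      rw [abs_of_nonneg (by positivity)]; nlinarith [ha.1, ha.2]
  simp only [collide, sum_sq_exchange hij]
  refine ⟨(integrable_const _).add (i2.mul_const _), ?_⟩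
  rw [integral_add (integrable_const _) (i2.mul_const _), integral_mul_const,
    integral_sq_add_sq_betaMeasure hγ]
  simp

theorem collideSum_sum_sq {γ : ℝ} (hγ : 0 < γ) {N : ℕ} (z : Fin N → ℝ) :
    collideSum γ (fun x => ∑ k, x k ^ 2) z = (pairCount N - pairGap γ N) * ∑ k, z k ^ 2 +
        (γ + 1) / (2 * γ + 1) * (∑ k, z k) ^ 2 := by
  rw [← sum_pairs_sq hγ z]
  refine Finset.sum_congr rfl fun p hp => ?_
  exact (collide_sum_sq hγ (Finset.mem_filter.1 hp).2.ne z).2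

theorem collideSum_linear {γ : ℝ} (hγ : 0 < γ) {N : ℕ} (b z : Fin N → ℝ) :
    collideSum γ (fun x => ∑ k, b k * x k) z = (pairCount N - N / 2) * ∑ k, b k * z k +
        (∑ k, b k) * (∑ k, z k) / 2 := by
  have hβ := isProbabilityMeasureBeta hγ hγ
  rw [← sum_pairs_linear b z]
  refine Finset.sum_congr rfl fun p hp => ?_
  have hij := (Finset.mem_filter.1 hp).2.ne
  have i1 : Integrable (fun a : ℝ => a) (betaMeasure γ γ) :=
    integrable_betaMeasure hγ (by fun_prop) (C := 1) fun a ha => by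
      rw [abs_of_pos ha.1]; exact ha.2.le
  have : ∀ a, ∑ k, b k * exchange p.1 p.2 a z k = a * ((b p.1 - b p.2) * (z p.1 + z p.2)) +
      (∑ k, b k * z k - b p.1 * z p.1 - b p.2 * z p.2 + b p.2 * (z p.1 + z p.2)) := by
    intro a
    rw [sum_exchange hij a z fun k x => b k * x]; ring
  simp only [collide, this]
  rw [integral_add (i1.mul_const _) (integrable_const _), integral_mul_const,
    integral_id_betaMeasure hγ]
  simp
  ring

/-- Collisions contract Hessian bounds at the rate at which they contract the square norm of
tangential vectors: a collision is linear in the configuration, so the deviation from linearity of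
the averaged function along a segment is controlled by the average of the square norm of the
collided difference of the end points. -/
theorem HessianBound.collideSum {N : ℕ} {ω t γ : ℝ} {f : (Fin N → ℝ) → ℝ} (hγ : 0 < γ)
    (hω : 0 < ω) (hρ : 0 ≤ pairCount N - pairGap γ N) (hf : HessianBound N ω t f) :
    HessianBound N ω ((pairCount N - pairGap γ N) * t) (collideSum γ f) := by
  have hβ := isProbabilityMeasureBeta hγ hγ
  refine ⟨mul_nonneg hρ hf.nonneg,
    Finset.measurable_sum _ fun p _ => measurable_collide hγ p.1 p.2 hf.measurable,
    fun x hx y hy u v hu hv huv => ?_⟩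
  have hxy : u • x + v • y ∈ energySimplex N ω := energySimplex_convex N ω hx hy hu hv huv
  have hpair : ∀ p : Fin N × Fin N, p.1 < p.2 →
      |u * collide γ p.1 p.2 f x + v * collide γ p.1 p.2 f y -
        collide γ p.1 p.2 f (u • x + v • y)| ≤
      t * (u * v) * collide γ p.1 p.2 (fun x => ∑ k, x k ^ 2) (x - y) := by
    intro p hp
    have hij := hp.ne
    have ix := hf.integrable_exchange hγ hω hij hx
    have iy := hf.integrable_exchange hγ hω hij hy
    have ixy := hf.integrable_exchange hγ hω hij hxy
    have iq := (collide_sum_sq hγ hij (x - y)).1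
    simp only [collide]
    have ixy' : Integrable (fun a => u * f (exchange p.1 p.2 a x) + v * f (exchange p.1 p.2 a y))
      (betaMeasure γ γ) := (ix.const_mul u).add (iy.const_mul v)
    rw [← integral_const_mul, ← integral_const_mul, ← integral_add (ix.const_mul u) (iy.const_mul v),
      ← integral_sub ixy' ixy, ← integral_const_mul,
      ← Real.norm_eq_abs]
    refine norm_integral_le_of_norm_le (iq.const_mul _) ?_
    filter_upwards [betaMeasure_mem_Ioo γ γ] with a ha
    have := hf.bound _ (exchange_mem_energySimplex hij ha hx) _
      (exchange_mem_energySimplex hij ha hy) u v hu hv huv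
    rw [← exchange_smul hij, ← exchange_smul hij, ← exchange_add hij] at this
    rw [Real.norm_eq_abs]
    refine this.trans (le_of_eq ?_)
    have hsub : exchange p.1 p.2 a (x - y) = exchange p.1 p.2 a x - exchange p.1 p.2 a y := by
      rw [eq_sub_iff_add_eq, ← exchange_add hij, sub_add_cancel]
    simp only [hsub, Pi.sub_apply]
    ring
  have hsum : u * EnergyExchange.collideSum γ f x + v * EnergyExchange.collideSum γ f y -
      EnergyExchange.collideSum γ f (u • x + v • y) =
      ∑ p : Fin N × Fin N with p.1 < p.2, (u * collide γ p.1 p.2 f x + v * collide γ p.1 p.2 f y -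
        collide γ p.1 p.2 f (u • x + v • y)) := by
    simp only [EnergyExchange.collideSum, Finset.mul_sum, ← Finset.sum_add_distrib,
      ← Finset.sum_sub_distrib]
  rw [hsum]
  refine (Finset.abs_sum_le_sum_abs _ _).trans ((Finset.sum_le_sum fun p hp =>
    hpair p (Finset.mem_filter.1 hp).2).trans (le_of_eq ?_))
  rw [← Finset.mul_sum]
  have hq := collideSum_sum_sq hγ (x - y)
  unfold EnergyExchange.collideSum at hq
  have h0 : ∑ k, (x - y) k = 0 := by
    simp only [Pi.sub_apply, Finset.sum_sub_distrib, hx.2, hy.2, sub_self]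
  rw [hq, h0]
  simp only [Pi.sub_apply]
  ring

theorem abs_exp_segment_le {B s r u v : ℝ} (hs : s ≤ B) (hr : r ≤ B) (hu : 0 ≤ u) (hv : 0 ≤ v)
    (huv : u + v = 1) :
    |u * Real.exp s + v * Real.exp r - Real.exp (u * s + v * r)| ≤
      Real.exp B * (u * v * (s - r) ^ 2) := by
  have h1 := convexOn_exp.2 (Set.mem_univ s) (Set.mem_univ r) hu hv huv
  have hconv : ConvexOn ℝ (Set.Iic B) fun x => Real.exp B * x ^ 2 - Real.exp x := by
    have hd : ∀ x, HasDerivAt (fun x => Real.exp B * x ^ 2 - Real.exp x)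
        (Real.exp B * (2 * x) - Real.exp x) x := fun x => by
      simpa using ((hasDerivAt_pow 2 x).const_mul (Real.exp B)).fun_sub (Real.hasDerivAt_exp x)
    have hd2 : ∀ x, HasDerivAt (fun x => Real.exp B * (2 * x) - Real.exp x)
        (Real.exp B * 2 - Real.exp x) x := fun x => by
      simpa using (((hasDerivAt_id x).const_mul 2).const_mul (Real.exp B)).fun_sub (Real.hasDerivAt_exp x)
    have hderiv : deriv (fun x => Real.exp B * x ^ 2 - Real.exp x) =
        fun x => Real.exp B * (2 * x) - Real.exp x := funext fun x => (hd x).deriv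
    refine convexOn_of_deriv2_nonneg (convex_Iic B) (by fun_prop) (by fun_prop) ?_ ?_
    · rw [hderiv]; fun_prop
    · intro x hx
      rw [interior_Iic] at hx
      simp only [Function.iterate_succ, Function.iterate_zero, Function.comp_apply, id]
      rw [hderiv, (hd2 x).deriv]
      have := Real.exp_le_exp.2 (le_of_lt (Set.mem_Iio.1 hx))
      linarith [Real.exp_pos B]
  have h2 := hconv.2 hs hr hu hv huv
  simp only [smul_eq_mul] at h1 h2
  rw [abs_of_nonneg (by linarith)]
  obtain rfl : v = 1 - u := by linarith
  linarith

theorem HessianBound.exp_linear {N : ℕ} {ω : ℝ} (b : Fin N → ℝ) :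
    ∃ t, HessianBound N ω t fun x => Real.exp (∑ k, b k * x k) := by
  set B := ∑ k, |b k| * ω with hB
  have hle : ∀ x ∈ energySimplex N ω, ∑ k, b k * x k ≤ B := by
    intro x hx
    refine Finset.sum_le_sum fun k _ => ?_
    refine mul_le_mul (le_abs_self _) ?_ (hx.1 k) (abs_nonneg _)
    rw [← hx.2]
    exact Finset.single_le_sum (f := x) (fun l _ => hx.1 l) (Finset.mem_univ k)
  refine ⟨Real.exp B * ∑ k, b k ^ 2,
    mul_nonneg (Real.exp_pos B).le (Finset.sum_nonneg fun k _ => sq_nonneg _), by fun_prop,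
    fun x hx y hy u v hu hv huv => ?_⟩
  have h1 := abs_exp_segment_le (hle x hx) (hle y hy) hu hv huv
  have h2 : ∑ k, b k * (u • x + v • y) k = u * ∑ k, b k * x k + v * ∑ k, b k * y k := by
    simp only [Finset.mul_sum, ← Finset.sum_add_distrib]
    refine Finset.sum_congr rfl fun k _ => ?_
    simp only [Pi.add_apply, Pi.smul_apply, smul_eq_mul]; ring
  rw [h2]
  refine h1.trans ?_
  have h3 : (∑ k, b k * x k - ∑ k, b k * y k) ^ 2 ≤
      (∑ k, b k ^ 2) * ∑ k, (x k - y k) ^ 2 := by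
    rw [← Finset.sum_sub_distrib]
    simp only [← mul_sub]
    exact Finset.sum_mul_sq_le_sq_mul_sq _ _ _
  have h4 := mul_le_mul_of_nonneg_left h3 (mul_nonneg (Real.exp_pos B).le (mul_nonneg hu hv))
  nlinarith [h4]

/-! ### Growth of powers of symmetric operators -/

/-- If the powers of a symmetric operator grow at most like `ρ ^ n` along a vector, the operator
expands that vector by at most `ρ`: the norms `‖T ^ n h‖` form a log-convex sequence. -/
theorem norm_apply_le_of_norm_pow_le {E : Type*} [NormedAddCommGroup E] [InnerProductSpace ℝ E]
    {T : E → E} (hT : ∀ x y, inner ℝ (T x) y = inner ℝ x (T y)) {h : E} {C ρ : ℝ} (hρ : 0 ≤ ρ)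
    (hC : ∀ n, ‖T^[n] h‖ ≤ C * ρ ^ n) (hT0 : T 0 = 0) : ‖T h‖ ≤ ρ * ‖h‖ := by
  set u : ℕ → ℝ := fun n => ‖T^[n] h‖ with hu
  have hlog : ∀ n, u (n + 1) ^ 2 ≤ u n * u (n + 2) := by
    intro n
    simp only [hu]
    rw [← real_inner_self_eq_norm_sq, Function.iterate_succ_apply' T n,
      Function.iterate_succ_apply' T (n + 1), Function.iterate_succ_apply' T n, hT]
    exact real_inner_le_norm _ _
  by_contra! hlt
  have hh : h ≠ 0 := by rintro rfl; rw [hT0] at hlt; simp at hlt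
  have h0 : 0 < u 0 := by simpa [hu] using hh
  have h1 : ρ * u 0 < u 1 := by simpa [hu] using hlt
  set r := u 1 / u 0 with hr
  have hρr : ρ < r := by rw [hr, lt_div_iff₀ h0]; exact h1
  have hr0 : 0 < r := lt_of_le_of_lt hρ hρr
  have hstep : ∀ n, 0 < u n ∧ r * u n ≤ u (n + 1) := by
    intro n
    induction n with
    | zero => exact ⟨h0, by rw [hr, div_mul_cancel₀ _ h0.ne']⟩
    | succ n ih =>
      have hpos : 0 < u (n + 1) := lt_of_lt_of_le (mul_pos hr0 ih.1) ih.2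
      refine ⟨hpos, ?_⟩
      have := hlog n
      have h2 : u n * (r * u (n + 1)) ≤ u n * u (n + 2) := by nlinarith [ih.2]
      exact le_of_mul_le_mul_left h2 ih.1
  have hgrow : ∀ n, r ^ n * u 0 ≤ u n := by
    intro n
    induction n with
    | zero => simp
    | succ n ih =>
      calc r ^ (n + 1) * u 0 = r * (r ^ n * u 0) := by ring
        _ ≤ r * u n := mul_le_mul_of_nonneg_left ih hr0.le
        _ ≤ u (n + 1) := (hstep n).2
  rcases hρ.eq_or_lt with rfl | hρ
  · have := (hgrow 1).trans (hC 1)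
    simp only [pow_one, mul_zero] at this
    exact absurd this (not_le.2 (mul_pos hr0 h0))
  · obtain ⟨n, hn⟩ := pow_unbounded_of_one_lt (C / u 0) ((one_lt_div hρ).2 hρr)
    have := (hgrow n).trans (hC n)
    rw [div_pow, div_lt_div_iff₀ h0 (pow_pos hρ n)] at hn
    linarith

/-! ### The collision operator on square integrable observables -/

/-- The operator `∑_{i<j} ν[· | η k, k ≠ i, j]` on `L²(ν)`. -/
noncomputable def collisionOperator {N : ℕ} (ν : Measure (Fin N → ℝ)) :
    Lp ℝ 2 ν →L[ℝ] Lp ℝ 2 ν :=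
  ∑ p : Fin N × Fin N with p.1 < p.2,
    (lpMeas ℝ ℝ (pairComplement p.1 p.2) 2 ν).subtypeL ∘L
      condExpL2 ℝ ℝ (pairComplement_le p.1 p.2)

theorem inner_collisionOperator {N : ℕ} (ν : Measure (Fin N → ℝ)) (g h : Lp ℝ 2 ν) :
    inner ℝ (collisionOperator ν g) h = inner ℝ g (collisionOperator ν h) := by
  simp only [collisionOperator, _root_.sum_apply, ContinuousLinearMap.comp_apply,
    Submodule.subtypeL_apply, sum_inner, inner_sum]
  exact Finset.sum_congr rfl fun p _ => inner_condExpL2_left_eq_right _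

theorem coeFn_collisionOperator {N : ℕ} (ν : Measure (Fin N → ℝ)) [IsFiniteMeasure ν]
    {f : (Fin N → ℝ) → ℝ} (hf : MemLp f 2 ν) :
    collisionOperator ν hf.toLp =ᵐ[ν] fun η =>
      ∑ p : Fin N × Fin N with p.1 < p.2, (ν[f | pairComplement p.1 p.2]) η := by
  simp only [collisionOperator, _root_.sum_apply, ContinuousLinearMap.comp_apply,
    Submodule.subtypeL_apply]
  refine (Lp.coeFn_finsetSum _ _).trans ?_
  have : ∀ᵐ η ∂ν, ∀ p : Fin N × Fin N,
      (condExpL2 ℝ ℝ (pairComplement_le p.1 p.2) hf.toLp : Lp ℝ 2 ν) η =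
        (ν[f | pairComplement p.1 p.2]) η :=
    ae_all_iff.2 fun p => hf.condExpL2_ae_eq_condExp (𝕜 := ℝ) (pairComplement_le p.1 p.2)
  filter_upwards [this] with η hη
  simp only [Finset.sum_apply, hη]

theorem coeFn_collisionOperator_eq_collideSum {γ : ℝ} (hγ : 0 < γ) {N : ℕ} {ω : ℝ} (hω : 0 ≤ ω)
    {f : (Fin N → ℝ) → ℝ} (hf : MemLp f 2 (condLaw γ N ω)) :
    collisionOperator (condLaw γ N ω) hf.toLp =ᵐ[condLaw γ N ω] collideSum γ f := by
  have hν := isProbabilityMeasure_condLaw hγ N ω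
  refine (coeFn_collisionOperator _ hf).trans ?_
  have : ∀ᵐ η ∂(condLaw γ N ω), ∀ p : Fin N × Fin N, p.1 < p.2 →
      collide γ p.1 p.2 f η = ((condLaw γ N ω)[f | pairComplement p.1 p.2]) η := by
    refine ae_all_iff.2 fun p => ?_
    by_cases hp : p.1 < p.2
    · filter_upwards [collide_ae_eq_condExp hγ hp.ne hω (hf.integrable one_le_two)] with η h _
        using h
    · exact Filter.Eventually.of_forall fun η h => absurd h hp
  filter_upwards [this] with η hη
  exact Finset.sum_congr rfl fun p hp => (hη p (Finset.mem_filter.1 hp).2).symm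

theorem ae_mem_energySimplex {γ : ℝ} (hγ : 0 < γ) {N : ℕ} (hN : 1 ≤ N) {ω : ℝ} (hω : 0 ≤ ω) :
    ∀ᵐ η ∂(condLaw γ N ω), η ∈ energySimplex N ω :=
  condLaw_sum_eq hγ hN hω

theorem HessianBound.memLp {γ : ℝ} (hγ : 0 < γ) {N : ℕ} (hN : 1 ≤ N) {ω t : ℝ} (hω : 0 < ω)
    {f : (Fin N → ℝ) → ℝ} (hf : HessianBound N ω t f) : MemLp f 2 (condLaw γ N ω) := by
  have hν := isProbabilityMeasure_condLaw hγ N ω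
  obtain ⟨C, hC⟩ := hf.exists_bound hω
  refine MemLp.of_bound hf.measurable.aestronglyMeasurable C ?_
  filter_upwards [ae_mem_energySimplex hγ hN hω.le] with η hη using hC η hη

/-- The classes in `L²` of the functions with a Hessian bound on the energy simplex. -/
def hessianBounded (γ : ℝ) (N : ℕ) (ω : ℝ) : Submodule ℝ (Lp ℝ 2 (condLaw γ N ω)) where
  carrier := {h | ∃ t f, HessianBound N ω t f ∧ h =ᵐ[condLaw γ N ω] f}
  add_mem' := by
    rintro g h ⟨t, f, hf, hg⟩ ⟨s, f', hf', hh⟩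
    exact ⟨t + s, f + f', hf.add hf', (Lp.coeFn_add g h).trans (hg.add hh)⟩
  zero_mem' := ⟨0, _, HessianBound.linear N ω 0, by
    filter_upwards [Lp.coeFn_zero ℝ 2 (condLaw γ N ω)] with η hη; simpa using hη⟩
  smul_mem' := by
    rintro c h ⟨t, f, hf, hh⟩
    refine ⟨|c| * t, c • f, hf.smul c, (Lp.coeFn_smul c h).trans ?_⟩
    filter_upwards [hh] with η hη
    simp [hη]

theorem isCompact_energySimplex (N : ℕ) (ω : ℝ) : IsCompact (energySimplex N ω) := by
  refine (isCompact_Icc (a := (0 : Fin N → ℝ)) (b := fun _ => ω)).of_isClosed_subset ?_ ?_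
  · refine IsClosed.inter (s₁ := {x : Fin N → ℝ | ∀ i, 0 ≤ x i})
      (s₂ := {x : Fin N → ℝ | ∑ i, x i = ω}) ?_ ?_
    · simp only [Set.ofPred_forall]
      exact isClosed_iInter fun i => isClosed_le continuous_const (continuous_apply i)
    · exact isClosed_eq (by fun_prop) continuous_const
  · intro x hx
    refine ⟨fun i => hx.1 i, fun i => ?_⟩
    change x i ≤ ω
    rw [← hx.2]
    exact Finset.single_le_sum (f := x) (fun l _ => hx.1 l) (Finset.mem_univ i)

/-- Continuous functions on the simplex are uniform limits of functions with Hessian bounds, by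
the Stone–Weierstrass theorem for linear combinations of exponentials. -/
theorem exists_hessianBound_near {N : ℕ} {ω : ℝ} {g : (Fin N → ℝ) → ℝ}
    (hg : Continuous g) {ε : ℝ} (hε : 0 < ε) :
    ∃ t f, HessianBound N ω t f ∧ ∀ x ∈ energySimplex N ω, |f x - g x| < ε := by
  have := isCompact_iff_compactSpace.1 (isCompact_energySimplex N ω)
  let e : (Fin N → ℝ) → C(energySimplex N ω, ℝ) := fun b =>
    ⟨fun x => Real.exp (∑ k, b k * x.1 k), Real.continuous_exp.comp (continuous_finsetSum _ fun k _ =>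
      continuous_const.mul ((continuous_apply k).comp continuous_subtype_val))⟩
  let S : Submonoid C(energySimplex N ω, ℝ) :=
    { carrier := Set.range e
      one_mem' := ⟨0, by ext x; simp [e]⟩
      mul_mem' := by
        rintro _ _ ⟨b, rfl⟩ ⟨c, rfl⟩
        refine ⟨b + c, ?_⟩
        ext x
        simp [e, add_mul, Finset.sum_add_distrib, Real.exp_add] }
  have hsep : (Algebra.adjoin ℝ (S : Set C(energySimplex N ω, ℝ))).SeparatesPoints := by
    intro x y hxy
    obtain ⟨k, hk⟩ : ∃ k, x.1 k ≠ y.1 k := by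
      by_contra! h
      exact hxy (Subtype.ext (funext h))
    refine ⟨_, ⟨e (Pi.single k 1), Algebra.subset_adjoin ⟨_, rfl⟩, rfl⟩, ?_⟩
    simpa [e, Pi.single_apply] using hk
  obtain ⟨⟨p, hp⟩, hpg⟩ := ContinuousMap.exists_mem_subalgebra_near_continuous_of_separatesPoints
    _ hsep (fun x => g x.1) (by fun_prop) ε hε
  have hspan : p ∈ Submodule.span ℝ (S : Set C(energySimplex N ω, ℝ)) := by
    rw [← Subalgebra.mem_toSubmodule, Algebra.adjoin_eq_span, Submonoid.closure_eq] at hp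
    exact hp
  obtain ⟨t, f, hf, hfp⟩ : ∃ t f, HessianBound N ω t f ∧ ∀ x : energySimplex N ω, p x = f x := by
    clear hpg hp
    induction hspan using Submodule.span_induction with
    | mem q hq =>
      obtain ⟨b, rfl⟩ := hq
      obtain ⟨t, ht⟩ := HessianBound.exp_linear (ω := ω) b
      exact ⟨t, _, ht, fun x => rfl⟩
    | zero => exact ⟨0, _, HessianBound.linear N ω 0, fun x => by simp⟩
    | add q r _ _ hq hr =>
      obtain ⟨t, f, hf, h1⟩ := hq
      obtain ⟨s, f', hf', h2⟩ := hr
      exact ⟨t + s, f + f', hf.add hf', fun x => by simp [h1, h2]⟩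
    | smul c q _ hq =>
      obtain ⟨t, f, hf, h1⟩ := hq
      exact ⟨|c| * t, c • f, hf.smul c, fun x => by simp [h1]⟩
  refine ⟨t, f, hf, fun x hx => ?_⟩
  have := hpg ⟨x, hx⟩
  rw [← hfp ⟨x, hx⟩]
  simpa using this

theorem dense_hessianBounded {γ : ℝ} (hγ : 0 < γ) {N : ℕ} (hN : 1 ≤ N) {ω : ℝ} (hω : 0 < ω) :
    Dense (hessianBounded γ N ω : Set (Lp ℝ 2 (condLaw γ N ω))) := by
  have hν := isProbabilityMeasure_condLaw hγ N ω
  have hd := BoundedContinuousFunction.toLp_denseRange ℝ (condLaw γ N ω) ℝ (p := 2) (by simp)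
  refine Dense.of_closure (hd.mono ?_)
  rintro _ ⟨g, rfl⟩
  refine Metric.mem_closure_iff.2 fun ε hε => ?_
  obtain ⟨t, f, hf, hfg⟩ := exists_hessianBound_near (ω := ω) g.continuous (half_pos hε)
  have hfL := hf.memLp hγ hN hω
  refine ⟨hfL.toLp, ⟨t, f, hf, hfL.coeFn_toLp⟩, ?_⟩
  rw [dist_eq_norm]
  have hb : ∀ᵐ η ∂(condLaw γ N ω),
      ‖(BoundedContinuousFunction.toLp 2 (condLaw γ N ω) ℝ g - hfL.toLp) η‖ ≤ ε / 2 := by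
    filter_upwards [Lp.coeFn_sub (BoundedContinuousFunction.toLp 2 (condLaw γ N ω) ℝ g) hfL.toLp,
      BoundedContinuousFunction.coeFn_toLp 2 (condLaw γ N ω) ℝ g, hfL.coeFn_toLp,
      ae_mem_energySimplex hγ hN hω.le] with η h1 h2 h3 h4
    rw [h1, Pi.sub_apply, h2, h3, Real.norm_eq_abs, abs_sub_comm]
    exact (hfg η h4).le
  have := Lp.norm_le_of_ae_bound (half_pos hε).le hb
  simp [measureUnivNNReal] at this
  linarith

/-! ### The spectral bound -/

theorem pairCount_sub_pairGap_nonneg {γ : ℝ} (hγ : 0 < γ) {N : ℕ} (hN : 2 ≤ N) :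
    0 ≤ pairCount N - pairGap γ N := by
  have h2 : (2 : ℝ) ≤ N := by exact_mod_cast hN
  have : pairCount N - pairGap γ N = (N - 2) * ((N - 1) / 2 + (γ + 1) / (2 * γ + 1)) := by
    unfold pairCount pairGap; field_simp; ring
  rw [this]
  have h3 : (0 : ℝ) ≤ N - 1 := by linarith
  exact mul_nonneg (by linarith) (by positivity)

theorem pairGap_le_half {γ : ℝ} (hγ : 0 < γ) {N : ℕ} (hN : 2 ≤ N) : pairGap γ N ≤ N / 2 := by
  have h2 : (2 : ℝ) ≤ N := by exact_mod_cast hN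
  rw [pairGap, div_le_div_iff₀ (by positivity) two_pos]
  nlinarith

/-- The class in `L²` of the linear function with coefficients `b`. Since the total energy is
almost surely constant, the constants are among them. -/
noncomputable def linearObservable {γ : ℝ} (hγ : 0 < γ) {N : ℕ} (hN : 1 ≤ N) {ω : ℝ} (hω : 0 < ω) :
    (Fin N → ℝ) →ₗ[ℝ] Lp ℝ 2 (condLaw γ N ω) where
  toFun b := ((HessianBound.linear N ω b).memLp hγ hN hω).toLp
  map_add' b c := by
    rw [← MemLp.toLp_add]
    congr 1
    ext x
    simp [add_mul, Finset.sum_add_distrib]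
  map_smul' r b := by
    rw [RingHom.id_apply, ← MemLp.toLp_const_smul]
    congr 1
    ext x
    simp [Finset.mul_sum, mul_assoc]

theorem coeFn_linearObservable {γ : ℝ} (hγ : 0 < γ) {N : ℕ} (hN : 1 ≤ N) {ω : ℝ}
    (hω : 0 < ω) (b : Fin N → ℝ) :
    linearObservable hγ hN hω b =ᵐ[condLaw γ N ω] fun x => ∑ k, b k * x k :=
  ((HessianBound.linear N ω b).memLp hγ hN hω).coeFn_toLp

theorem inner_linearObservable_one {γ : ℝ} (hγ : 0 < γ) {N : ℕ} (hN : 1 ≤ N) {ω : ℝ}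
    (hω : 0 < ω) (h : Lp ℝ 2 (condLaw γ N ω)) :
    inner ℝ h (linearObservable hγ hN hω 1) = ω * ∫ η, h η ∂(condLaw γ N ω) := by
  rw [L2.inner_def, ← integral_const_mul]
  refine integral_congr_ae ?_
  filter_upwards [coeFn_linearObservable hγ hN hω 1, ae_mem_energySimplex hγ hN hω.le] with η h1 h2
  rw [h1]
  simp [h2.2]

theorem collisionOperator_linearObservable {γ : ℝ} (hγ : 0 < γ) {N : ℕ} (hN : 1 ≤ N) {ω : ℝ}
    (hω : 0 < ω) (b : Fin N → ℝ) :
    collisionOperator (condLaw γ N ω) (linearObservable hγ hN hω b) =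
      (pairCount N - N / 2) • linearObservable hγ hN hω b +
        ((∑ k, b k) / 2) • linearObservable hγ hN hω 1 := by
  rw [← map_smul, ← map_smul, ← map_add]
  refine Lp.ext ((coeFn_collisionOperator_eq_collideSum hγ hω.le
    ((HessianBound.linear N ω b).memLp hγ hN hω)).trans ?_)
  refine Filter.EventuallyEq.trans ?_ (coeFn_linearObservable hγ hN hω _).symm
  filter_upwards with η
  have : ∑ k, ((pairCount N - N / 2) • b + ((∑ l, b l) / 2) • (1 : Fin N → ℝ)) k * η k =
      (pairCount N - N / 2) * ∑ k, b k * η k + (∑ l, b l) / 2 * ∑ k, η k := by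
    rw [Finset.mul_sum, Finset.mul_sum, ← Finset.sum_add_distrib]
    refine Finset.sum_congr rfl fun k _ => ?_
    simp only [Pi.add_apply, Pi.smul_apply, Pi.one_apply, smul_eq_mul]
    ring
  rw [collideSum_linear hγ, this]
  ring

theorem collisionOperator_ae_eq {γ : ℝ} (hγ : 0 < γ) {N : ℕ} (hN : 1 ≤ N) {ω : ℝ}
    (hω : 0 < ω) {t : ℝ} {f : (Fin N → ℝ) → ℝ} (hf : HessianBound N ω t f)
    {h : Lp ℝ 2 (condLaw γ N ω)} (hh : h =ᵐ[condLaw γ N ω] f) :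
    collisionOperator (condLaw γ N ω) h =ᵐ[condLaw γ N ω] collideSum γ f := by
  have hfL := hf.memLp hγ hN hω
  have : h = hfL.toLp := Lp.ext (hh.trans hfL.coeFn_toLp.symm)
  rw [this]
  exact coeFn_collisionOperator_eq_collideSum hγ hω.le hfL

/-- An observable orthogonal to the linear ones is bounded in `L²` by its Hessian bound. -/
theorem norm_le_of_hessianBound {γ : ℝ} (hγ : 0 < γ) {N : ℕ} (hN : 1 ≤ N) {ω : ℝ}
    (hω : 0 < ω) {t : ℝ} {f : (Fin N → ℝ) → ℝ} (hf : HessianBound N ω t f)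
    {h : Lp ℝ 2 (condLaw γ N ω)} (hh : h =ᵐ[condLaw γ N ω] f)
    (ho : h ∈ (LinearMap.range (linearObservable hγ hN hω))ᗮ) : ‖h‖ ≤ t * ω ^ 2 := by
  have hν := isProbabilityMeasure_condLaw hγ N ω
  set b : Fin N → ℝ := fun k => f (Pi.single k ω) / ω with hb
  have h0 : inner ℝ h (linearObservable hγ hN hω b) = 0 := by
    rw [real_inner_comm]
    exact ho _ ⟨b, rfl⟩
  have h1 : ‖h - linearObservable hγ hN hω b‖ ≤ t * ω ^ 2 := by
    have hae : ∀ᵐ η ∂(condLaw γ N ω), ‖(h - linearObservable hγ hN hω b) η‖ ≤ t * ω ^ 2 := by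
      filter_upwards [Lp.coeFn_sub h (linearObservable hγ hN hω b), hh,
        coeFn_linearObservable hγ hN hω b, ae_mem_energySimplex hγ hN hω.le] with η e1 e2 e3 e4
      rw [e1, Pi.sub_apply, e2, e3]
      exact hf.abs_sub_interpolation_le hω e4
    have := Lp.norm_le_of_ae_bound (mul_nonneg hf.nonneg (sq_nonneg ω)) hae
    simpa [measureUnivNNReal] using this
  have h2 : ‖h‖ ^ 2 ≤ ‖h‖ * (t * ω ^ 2) := by
    rw [← real_inner_self_eq_norm_sq]
    calc inner ℝ h h = inner ℝ h (h - linearObservable hγ hN hω b) := by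
          rw [inner_sub_right, h0, sub_zero]
      _ ≤ ‖h‖ * ‖h - linearObservable hγ hN hω b‖ := real_inner_le_norm _ _
      _ ≤ _ := mul_le_mul_of_nonneg_left h1 (norm_nonneg _)
  by_contra! hlt
  have hpos : 0 < ‖h‖ := lt_of_le_of_lt (mul_nonneg hf.nonneg (sq_nonneg ω)) hlt
  nlinarith

theorem collisionOperator_mem_orthogonal {γ : ℝ} (hγ : 0 < γ) {N : ℕ} (hN : 1 ≤ N) {ω : ℝ}
    (hω : 0 < ω) {h : Lp ℝ 2 (condLaw γ N ω)}
    (ho : h ∈ (LinearMap.range (linearObservable hγ hN hω))ᗮ) :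
    collisionOperator (condLaw γ N ω) h ∈ (LinearMap.range (linearObservable hγ hN hω))ᗮ := by
  rintro _ ⟨b, rfl⟩
  rw [← inner_collisionOperator, collisionOperator_linearObservable, ← map_smul, ← map_smul,
    ← map_add]
  exact ho _ ⟨_, rfl⟩

/-- On the orthogonal complement of the linear observables the collision operator is bounded by the
rate at which it contracts Hessians. -/
theorem norm_collisionOperator_le {γ : ℝ} (hγ : 0 < γ) {N : ℕ} (hN : 1 ≤ N) {ω : ℝ}
    (hω : 0 < ω) (hN2 : 2 ≤ N) {h : Lp ℝ 2 (condLaw γ N ω)}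
    (ho : h ∈ (LinearMap.range (linearObservable hγ hN hω))ᗮ) :
    ‖collisionOperator (condLaw γ N ω) h‖ ≤ (pairCount N - pairGap γ N) * ‖h‖ := by
  set V := LinearMap.range (linearObservable hγ hN hω) with hV
  set R := collisionOperator (condLaw γ N ω) with hR
  have hρ := pairCount_sub_pairGap_nonneg hγ hN2
  set ρ := pairCount N - pairGap γ N with hρ'
  have hreg : ∀ g ∈ Vᗮ, g ∈ hessianBounded γ N ω → ‖R g‖ ≤ ρ * ‖g‖ := by
    rintro g hg ⟨t, f, hf, hgf⟩
    refine norm_apply_le_of_norm_pow_le (inner_collisionOperator _) (C := t * ω ^ 2) hρ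
      (fun n => ?_) (map_zero _)
    have hiter : R^[n] g ∈ Vᗮ ∧ ∃ f', HessianBound N ω (ρ ^ n * t) f' ∧
        R^[n] g =ᵐ[condLaw γ N ω] f' := by
      induction n with
      | zero => exact ⟨hg, f, by simpa using hf, hgf⟩
      | succ n ih =>
        obtain ⟨ih1, f', ih2, ih3⟩ := ih
        rw [Function.iterate_succ_apply']
        refine ⟨collisionOperator_mem_orthogonal hγ hN hω ih1, collideSum γ f', ?_,
          collisionOperator_ae_eq hγ hN hω ih2 ih3⟩
        have := ih2.collideSum hγ hω hρ
        rwa [← mul_assoc, ← pow_succ'] at this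
    obtain ⟨h1, f', h2, h3⟩ := hiter
    exact (norm_le_of_hessianBound hγ hN hω h2 h3 h1).trans (le_of_eq (by ring))
  have hclosed : IsClosed {g : Lp ℝ 2 (condLaw γ N ω) |
      ‖R (Vᗮ.starProjection g)‖ ≤ ρ * ‖Vᗮ.starProjection g‖} :=
    isClosed_le (by fun_prop) (by fun_prop)
  have hall : closure (hessianBounded γ N ω : Set (Lp ℝ 2 (condLaw γ N ω))) ⊆
      {g | ‖R (Vᗮ.starProjection g)‖ ≤ ρ * ‖Vᗮ.starProjection g‖} := by
    refine hclosed.closure_subset_iff.2 fun g hg =>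
      hreg _ (Submodule.starProjection_apply_mem _ _) ?_
    rw [Submodule.starProjection_orthogonal_val]
    refine sub_mem hg ?_
    obtain ⟨b, hb⟩ := Submodule.starProjection_apply_mem V g
    rw [← hb]
    exact ⟨0, _, HessianBound.linear N ω b, coeFn_linearObservable hγ hN hω b⟩
  have := hall (dense_hessianBounded hγ hN hω h)
  rwa [Set.mem_ofPred_eq, Submodule.starProjection_eq_self_iff.2 ho] at this

/-- The quadratic form of the collision operator on mean zero observables. -/
theorem inner_collisionOperator_self_le {γ : ℝ} (hγ : 0 < γ) {N : ℕ} (hN : 1 ≤ N) {ω : ℝ}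
    (hω : 0 < ω) (hN2 : 2 ≤ N) {h : Lp ℝ 2 (condLaw γ N ω)}
    (hh : ∫ η, h η ∂(condLaw γ N ω) = 0) :
    inner ℝ h (collisionOperator (condLaw γ N ω) h) ≤ (pairCount N - pairGap γ N) * ‖h‖ ^ 2 := by
  set V := LinearMap.range (linearObservable hγ hN hω) with hV
  set R := collisionOperator (condLaw γ N ω) with hR
  obtain ⟨v, hv, w, hw, rfl⟩ := V.exists_add_mem_mem_orthogonal h
  have hone : inner ℝ (v + w) (linearObservable hγ hN hω 1) = 0 := by
    rw [inner_linearObservable_one, hh, mul_zero]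
  have hw1 : ∀ x ∈ V, inner ℝ w x = 0 := fun x hx => by rw [real_inner_comm]; exact hw x hx
  rw [inner_add_left, hw1 _ ⟨1, rfl⟩, add_zero] at hone
  obtain ⟨b, hb⟩ := hv
  have hRv : R v = (pairCount N - N / 2) • v + ((∑ k, b k) / 2) • linearObservable hγ hN hω 1 := by
    rw [← hb]; exact collisionOperator_linearObservable hγ hN hω b
  have hRV : R v ∈ V := by
    rw [hRv]
    exact add_mem (V.smul_mem _ ⟨b, hb⟩) (V.smul_mem _ ⟨1, rfl⟩)
  have hvw : inner ℝ v w = 0 := by rw [real_inner_comm]; exact hw1 v ⟨b, hb⟩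
  have e1 : inner ℝ v (R w) = 0 := by
    rw [← inner_collisionOperator]; exact hw _ hRV
  have e2 : inner ℝ w (R v) = 0 := hw1 _ hRV
  have e3 : inner ℝ v (R v) = (pairCount N - N / 2) * ‖v‖ ^ 2 := by
    rw [hRv, inner_add_right, inner_smul_right, inner_smul_right, hone,
      real_inner_self_eq_norm_sq, mul_zero, add_zero]
  have e4 : inner ℝ w (R w) ≤ (pairCount N - pairGap γ N) * ‖w‖ ^ 2 := by
    calc inner ℝ w (R w) ≤ ‖w‖ * ‖R w‖ := real_inner_le_norm _ _
      _ ≤ ‖w‖ * ((pairCount N - pairGap γ N) * ‖w‖) :=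
        mul_le_mul_of_nonneg_left (norm_collisionOperator_le hγ hN hω hN2 hw) (norm_nonneg _)
      _ = _ := by ring
  have e5 : ‖v + w‖ ^ 2 = ‖v‖ ^ 2 + ‖w‖ ^ 2 := by
    rw [← real_inner_self_eq_norm_sq, ← real_inner_self_eq_norm_sq, ← real_inner_self_eq_norm_sq,
      inner_add_left, inner_add_right, inner_add_right, hvw, hw1 v ⟨b, hb⟩]
    ring
  have e6 := mul_le_mul_of_nonneg_right (pairGap_le_half hγ hN2) (sq_nonneg ‖v‖)
  rw [map_add, inner_add_left, inner_add_right, inner_add_right, e1, e2, e3, e5]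
  linarith

theorem integral_mul_neg_averageGenerator {N : ℕ} (ν : Measure (Fin N → ℝ)) [IsFiniteMeasure ν]
    {f : (Fin N → ℝ) → ℝ} (hf : MemLp f 2 ν) :
    ∫ η, f η * (-(averageGenerator ν f η)) ∂ν =
      (1 / N) * (pairCount N * ∫ η, f η ^ 2 ∂ν - ∫ η, f η * collisionOperator ν hf.toLp η ∂ν) := by
  have i1 : Integrable (fun η => f η ^ 2) ν := hf.integrable_sq
  have i2 : Integrable (fun η => f η * collisionOperator ν hf.toLp η) ν :=
    hf.integrable_mul (Lp.memLp _)
  rw [← integral_const_mul, ← integral_sub (i1.const_mul _) i2, ← integral_const_mul]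
  refine integral_congr_ae ?_
  filter_upwards [coeFn_collisionOperator ν hf] with η hη
  rw [hη, averageGenerator, Finset.sum_sub_distrib, sum_pairs_const]
  ring

theorem norm_toLp_sq {N : ℕ} (ν : Measure (Fin N → ℝ))
    {f : (Fin N → ℝ) → ℝ} (hf : MemLp f 2 ν) : ‖hf.toLp‖ ^ 2 = ∫ η, f η ^ 2 ∂ν := by
  rw [← real_inner_self_eq_norm_sq, L2.inner_def]
  refine integral_congr_ae ?_
  filter_upwards [hf.coeFn_toLp] with η hη
  rw [hη]
  simp [sq]

theorem pairGap_mul_le {γ : ℝ} (hγ : 0 < γ) {N : ℕ} (hN : 2 ≤ N) {ω : ℝ} (hω : 0 < ω)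
    {f : (Fin N → ℝ) → ℝ} (hf : MemLp f 2 (condLaw γ N ω)) (h0 : ∫ η, f η ∂(condLaw γ N ω) = 0) :
    (1 / N) * (pairGap γ N * ∫ η, f η ^ 2 ∂(condLaw γ N ω)) ≤
      ∫ η, f η * (-(averageGenerator (condLaw γ N ω) f η)) ∂(condLaw γ N ω) := by
  have hν := isProbabilityMeasure_condLaw hγ N ω
  have hmean : ∫ η, (hf.toLp f) η ∂(condLaw γ N ω) = 0 := by
    rw [integral_congr_ae hf.coeFn_toLp, h0]
  have h := inner_collisionOperator_self_le hγ (one_le_two.trans hN) hω hN hmean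
  have hin : inner ℝ hf.toLp (collisionOperator (condLaw γ N ω) hf.toLp) =
      ∫ η, f η * collisionOperator (condLaw γ N ω) hf.toLp η ∂(condLaw γ N ω) := by
    rw [L2.inner_def]
    refine integral_congr_ae ?_
    filter_upwards [hf.coeFn_toLp] with η hη
    rw [hη]
    simp [mul_comm]
  rw [hin, norm_toLp_sq] at h
  rw [integral_mul_neg_averageGenerator _ hf]
  refine mul_le_mul_of_nonneg_left ?_ (by positivity)
  linarith

/-! ### The sum of squared energies attains the gap -/

theorem HessianBound.sum_sq_sub_const (N : ℕ) (ω m : ℝ) :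
    HessianBound N ω 1 fun x => ∑ k, x k ^ 2 - m := by
  refine ⟨zero_le_one, by fun_prop, fun x _ y _ u v hu hv huv => ?_⟩
  have : u * (∑ k, x k ^ 2 - m) + v * (∑ k, y k ^ 2 - m) - (∑ k, (u • x + v • y) k ^ 2 - m) =
      u * v * ∑ k, (x k - y k) ^ 2 := by
    rw [← sum_sq_segment x y huv]
    obtain rfl : v = 1 - u := by linarith
    ring
  rw [this, one_mul, abs_of_nonneg]
  exact mul_nonneg (mul_nonneg hu hv) (Finset.sum_nonneg fun k _ => sq_nonneg _)

theorem collideSum_sum_sq_sub_const {γ : ℝ} (hγ : 0 < γ) {N : ℕ} (m : ℝ) (z : Fin N → ℝ) :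
    collideSum γ (fun x => ∑ k, x k ^ 2 - m) z = (pairCount N - pairGap γ N) * ∑ k, z k ^ 2 +
        (γ + 1) / (2 * γ + 1) * (∑ k, z k) ^ 2 - pairCount N * m := by
  have hβ := isProbabilityMeasureBeta hγ hγ
  rw [← collideSum_sum_sq hγ, collideSum, collideSum, ← sum_pairs_const, ← Finset.sum_sub_distrib]
  refine Finset.sum_congr rfl fun p hp => ?_
  have hi := (collide_sum_sq hγ (Finset.mem_filter.1 hp).2.ne z).1
  simp only [collide]
  rw [integral_sub hi (integrable_const _)]
  simp

theorem condLaw_pos_ae {γ : ℝ} (hγ : 0 < γ) {N : ℕ} (hN : 1 ≤ N) {ω : ℝ} (hω : 0 < ω) :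
    ∀ᵐ η ∂(condLaw γ N ω), ∀ i, 0 < η i := by
  have hm : MeasurableSet {η : Fin N → ℝ | ∀ i, 0 < η i} := by measurability
  rw [condLaw, ae_map_iff (measurable_rescale N ω).aemeasurable hm]
  filter_upwards [productLaw_pos_ae hγ N, productLaw_sum_pos_ae hγ hN] with η h1 h2 i
  exact mul_pos (div_pos hω h2) (h1 i)

/-- The sum of the squared energies is not almost surely constant: a collision changes it. -/
theorem integral_sum_sq_sub_const_sq_ne_zero {γ : ℝ} (hγ : 0 < γ) {N : ℕ} (hN : 2 ≤ N) {ω : ℝ}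
    (hω : 0 < ω) (m : ℝ) : ∫ η, (∑ k, η k ^ 2 - m) ^ 2 ∂(condLaw γ N ω) ≠ 0 := by
  have hβ := isProbabilityMeasureBeta hγ hγ
  have hν := isProbabilityMeasure_condLaw hγ N ω
  have hN1 := one_le_two.trans hN
  intro h
  rw [integral_eq_zero_iff_of_nonneg (fun _ => sq_nonneg _)
    ((HessianBound.sum_sq_sub_const N ω m).memLp hγ hN1 hω).integrable_sq] at h
  let i : Fin N := ⟨0, by omega⟩
  let j : Fin N := ⟨1, by omega⟩
  have hij : i ≠ j := by simp [i, j]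
  have hae := Measure.ae_ae_of_ae_prod
    ((measurePreserving_exchange hγ hij ω).quasiMeasurePreserving.ae h)
  obtain ⟨η, h1, h2⟩ := (hae.and (condLaw_pos_ae hγ hN1 hω)).exists
  have hs : 0 < η i + η j := add_pos (h2 i) (h2 j)
  set s := η i + η j with hs'
  -- the fractions `a` after which the sum of squares equals `m` solve `(2 * a - 1) ^ 2 = d`
  set d := 2 * (m - (∑ k, η k ^ 2 - η i ^ 2 - η j ^ 2)) / s ^ 2 - 1 with hd
  have hne : ∀ c : ℝ, ∀ᵐ a ∂(betaMeasure γ γ), a ≠ c := fun c =>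
    (withDensity_absolutelyContinuous _ _).ae_le (Measure.ae_ne volume c)
  obtain ⟨a, ha, ha1, ha2⟩ :=
    (h1.and ((hne ((1 + √d) / 2)).and (hne ((1 - √d) / 2)))).exists
  have hz : ∑ k, exchange i j a η k ^ 2 - m = 0 := by simpa using ha
  rw [sum_sq_exchange hij] at hz
  have hda : d = (2 * a - 1) ^ 2 := by
    have : s ^ 2 ≠ 0 := by positivity
    rw [hd, sub_eq_iff_eq_add, div_eq_iff this]
    linear_combination -2 * hz
  have hsqrt : √d = |2 * a - 1| := by rw [hda, Real.sqrt_sq_eq_abs]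
  rcases abs_choice (2 * a - 1) with h' | h'
  · exact ha1 (by rw [hsqrt, h']; ring)
  · exact ha2 (by rw [hsqrt, h']; ring)

theorem integral_sum_sq_mul_neg_averageGenerator {γ : ℝ} (hγ : 0 < γ) {N : ℕ} (hN : 1 ≤ N) {ω : ℝ}
    (hω : 0 < ω) {m : ℝ} (hm : ∫ η, (∑ k, η k ^ 2 - m) ∂(condLaw γ N ω) = 0) :
    ∫ η, (∑ k, η k ^ 2 - m) * (-(averageGenerator (condLaw γ N ω)
        (fun x => ∑ k, x k ^ 2 - m) η)) ∂(condLaw γ N ω) =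
      (1 / N) * (pairGap γ N * ∫ η, (∑ k, η k ^ 2 - m) ^ 2 ∂(condLaw γ N ω)) := by
  have hν := isProbabilityMeasure_condLaw hγ N ω
  have hf := HessianBound.sum_sq_sub_const N ω m
  have hfL := hf.memLp hγ hN hω
  rw [integral_mul_neg_averageGenerator _ hfL]
  set C := (pairCount N - pairGap γ N) * m + (γ + 1) / (2 * γ + 1) * ω ^ 2 - pairCount N * m with hC
  have : ∫ η, (∑ k, η k ^ 2 - m) * collisionOperator (condLaw γ N ω) hfL.toLp η ∂(condLaw γ N ω) =
      ∫ η, ((pairCount N - pairGap γ N) * (∑ k, η k ^ 2 - m) ^ 2 + C * (∑ k, η k ^ 2 - m))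
        ∂(condLaw γ N ω) := by
    refine integral_congr_ae ?_
    filter_upwards [coeFn_collisionOperator_eq_collideSum hγ hω.le hfL,
      ae_mem_energySimplex hγ hN hω.le] with η h1 h2
    rw [h1, collideSum_sum_sq_sub_const hγ, h2.2, hC]
    ring
  rw [this, integral_add (hfL.integrable_sq.const_mul _) ((hfL.integrable one_le_two).const_mul _),
    integral_const_mul, integral_const_mul, hm]
  ring

theorem gapAt_eq {γ : ℝ} (hγ : 0 < γ) {N : ℕ} (hN : 2 ≤ N) {ω : ℝ} (hω : 0 < ω) :
    gapAt γ N ω = (((γ * N + 1) / (N * (2 * γ + 1)) : ℝ) : EReal) := by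
  have hν := isProbabilityMeasure_condLaw hγ N ω
  have hN1 := one_le_two.trans hN
  have hN0 : (N : ℝ) ≠ 0 := by positivity
  have hc : (γ * N + 1) / (N * (2 * γ + 1)) = 1 / N * pairGap γ N := by
    unfold pairGap; field_simp
  rw [hc]
  refine le_antisymm ?_ ?_
  · set m := ∫ η, ∑ k, η k ^ 2 ∂(condLaw γ N ω) with hm
    have hfL := (HessianBound.sum_sq_sub_const N ω m).memLp hγ hN1 hω
    have hq : Integrable (fun η : Fin N → ℝ => ∑ k, η k ^ 2) (condLaw γ N ω) := by
      simpa using ((HessianBound.sum_sq_sub_const N ω 0).memLp hγ hN1 hω).integrable one_le_two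
    have h0 : ∫ η, (∑ k, η k ^ 2 - m) ∂(condLaw γ N ω) = 0 := by
      rw [integral_sub hq (integrable_const _), ← hm]; simp
    have hne := integral_sum_sq_sub_const_sq_ne_zero hγ hN hω m
    refine iInf₂_le_of_le _ ⟨hfL, h0, hne⟩ (EReal.coe_le_coe_iff.2 (le_of_eq ?_))
    rw [integral_sum_sq_mul_neg_averageGenerator hγ hN1 hω h0, ← mul_assoc, mul_div_assoc,
      div_self hne, mul_one]
  · refine le_iInf₂ fun f hf => EReal.coe_le_coe_iff.2 ?_
    have hpos : 0 < ∫ η, f η ^ 2 ∂(condLaw γ N ω) :=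
      lt_of_le_of_ne (integral_nonneg fun _ => sq_nonneg _) hf.2.2.symm
    rw [le_div_iff₀ hpos, mul_assoc]
    exact pairGap_mul_le hγ hN hω hf.1 hf.2.1

end EnergyExchange

theorem mainTheorem7 (γ : ℝ) (hγ : 0 < γ) (N : ℕ) (hN : 2 ≤ N) :
    (∀ ω : ℝ, 0 < ω → ∀ f : (Fin N → ℝ) → ℝ,
      MeasureTheory.MemLp f 2 (EnergyExchange.condLaw γ N ω) →
      EnergyExchange.exchangeGenerator γ f =ᵐ[EnergyExchange.condLaw γ N ω]
        EnergyExchange.averageGenerator (EnergyExchange.condLaw γ N ω) f) ∧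
    (∀ ω : ℝ, 0 < ω →
      EnergyExchange.gapAt γ N ω = (((γ * N + 1) / (N * (2 * γ + 1)) : ℝ) : EReal)) ∧
    EnergyExchange.gap γ N = (((γ * N + 1) / (N * (2 * γ + 1)) : ℝ) : EReal) := by
  refine ⟨fun ω hω f hf => ?_, fun ω hω => EnergyExchange.gapAt_eq hγ hN hω, ?_⟩
  · have := EnergyExchange.isProbabilityMeasure_condLaw hγ N ω
    exact EnergyExchange.exchangeGenerator_ae_eq_averageGenerator hγ hω.le
      (hf.integrable one_le_two)
  · refine le_antisymm ?_ ?_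
    · exact iInf₂_le_of_le 1 one_pos (EnergyExchange.gapAt_eq hγ hN one_pos).le
    · exact le_iInf₂ fun ω hω => (EnergyExchange.gapAt_eq hγ hN hω).ge
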